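/- Let $N\ge 1$ be an integer and let $p,q,\alpha$ be real numbers with $$1<p<N,\qquad p-1<q\le\frac{(N+\alpha)(p-1)}{N-p}.$$ For an open set $\Omega\subset\mathbb R^N$, a function $u$ is called a continuous solution of $-\Delta_p u=|x|^\alpha u^q$ in $\Omega$, where $\Delta_p u=\operatorname{div}(|\nabla u|^{p-2}\nabla u)$, if $u$ is continuous in $\Omega$, its distributional gradient satisfies $\nabla u\in L^p_{\rm loc}(\Omega)$, and $$\int_\Omega|\nabla u|^{p-2}\nabla u\cdot\nabla\varphi\,dx=\int_\Omega|x|^\alpha u^q\varphi\,dx\qquad\text{for all }\varphi\in C_c^\infty(\Omega).$$ Then the equation $-\Delta_p u=|x|^\alpha u^q$ has no positive continuous solution (radial or not) in the exterior domain $\{x\in\mathbb R^N:|x|>1\}$. In particular it has none in $\{x\in\mathbb R^N:|x|\ge1\}$, that is, no function that is continuous and positive for $|x|\ge1$ and is a continuous solution in $\{|x|>1\}$. -/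

import Mathlib

open MeasureTheory TopologicalSpace
open scoped Distributions

namespace PLaplaceHenon

/-- `ℝ^N` with its Euclidean norm and Lebesgue measure. -/
abbrev Space (N : ℕ) : Type := EuclideanSpace ℝ (Fin N)

/-- `g` is the weak (distributional) gradient of `u` in the open set `Ω`:
`∫_Ω u ∂_v φ = - ∫_Ω (g · v) φ` for every direction `v` and every `φ ∈ C_c^∞(Ω)`. -/
structure HasWeakGradient {N : ℕ} (Ω : Opens (Space N)) (u : Space N → ℝ)
    (g : Space N → Space N) : Prop where
  locallyIntegrableOn : LocallyIntegrableOn u (Ω : Set (Space N)) volume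
  locallyIntegrableOn_grad : LocallyIntegrableOn g (Ω : Set (Space N)) volume
  integral_eq : ∀ (v : Space N) (φ : 𝓓(Ω, ℝ)),
    ∫ x in (Ω : Set (Space N)), u x * fderiv ℝ φ x v
      = -∫ x in (Ω : Set (Space N)), inner ℝ (g x) v * φ x

/-- `g ∈ L^p_loc(Ω)`: `g` is in `L^p` on every compact subset of `Ω`. -/
def MemLpLoc {N : ℕ} (p : ℝ) (Ω : Opens (Space N)) (g : Space N → Space N) : Prop :=
  ∀ K : Set (Space N), IsCompact K → K ⊆ Ω → MemLp g (ENNReal.ofReal p) (volume.restrict K)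

/-- `u` is a continuous solution of `-Δ_p u = |x|^α u^q` in the open set `Ω`:
`u` is continuous in `Ω`, has a weak gradient `∇u ∈ L^p_loc(Ω)`, and
`∫_Ω |∇u|^{p-2} ∇u · ∇φ = ∫_Ω |x|^α u^q φ` for every `φ ∈ C_c^∞(Ω)`. -/
def IsContinuousSolution {N : ℕ} (p α q : ℝ) (Ω : Opens (Space N)) (u : Space N → ℝ) : Prop :=
  ContinuousOn u (Ω : Set (Space N)) ∧
  ∃ g : Space N → Space N, HasWeakGradient Ω u g ∧ MemLpLoc p Ω g ∧
    ∀ φ : 𝓓(Ω, ℝ),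
      ∫ x in (Ω : Set (Space N)), inner ℝ ((‖g x‖ ^ (p - 2)) • g x) (gradient φ x)
        = ∫ x in (Ω : Set (Space N)), ‖x‖ ^ α * u x ^ q * φ x

/-- The open exterior domain `{x ∈ ℝ^N : |x| > 1}`. -/
def exteriorDomain (N : ℕ) : Opens (Space N) :=
  ⟨{x | 1 < ‖x‖}, isOpen_lt continuous_const continuous_norm⟩

end PLaplaceHenon

/-! Suppose `u` is a positive solution in the exterior domain, and put β = (N - p)/(p - 1), the
decay rate of the radial p-harmonic function |x|^(-β). Lower and upper information on `u` turn out
to be incompatible by a logarithm.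

Lower bound (`IsWeakSol.exists_lower_bound`). The right-hand side is positive, so comparison with
p-harmonic radial barriers that vanish on a large sphere gives u ≥ c₁|x|^(-β). Since βq ≤ N + α, the
right-hand side is then at least a multiple of |x|^(-N). This is the borderline source: a radial
barrier with flux proportional to (1 + log(|x|/2))|x|^(-N) x has exactly such a source, and a second
comparison improves the bound to u ≥ c (1 + log(|x|/2))^(1/(p-1)) |x|^(-β).

Upper bound (`IsWeakSol.exists_potential_bound`). Testing the equation with ψ^k u^(1-p) (Picone)
shows that the potential |x|^α u^(q-p+1) cannot stay above C R^(-p) on the whole annulus 3R ≤ |x| ≤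
5R.

Conflict. Because α - β(q - p + 1) ≥ -p, the lower bound makes the potential at least a constant
times (log R)^((q-p+1)/(p-1)) R^(-p) on that annulus. The exponent of the logarithm is positive
since q > p - 1, so large R gives a contradiction.

Both comparison and Picone need test functions that are nonlinear in `u`; `weak_equation_test_comp`
justifies them by mollification. -/

namespace PLaplaceHenon

open Filter Set Metric ContinuousLinearMap
open scoped Topology ContDiff Convolution ENNReal Gradient

/-! ### Unbundled smooth compactly supported test functions. -/

section TestFunctions

variable {E : Type*} [NormedAddCommGroup E] [InnerProductSpace ℝ E]

/-- `φ ∈ C_c^∞(Ω)`, for an unbundled function `φ`. -/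
structure IsTest (Ω : Set E) (φ : E → ℝ) : Prop where
  contDiff : ContDiff ℝ ∞ φ
  compact : HasCompactSupport φ
  subset : tsupport φ ⊆ Ω

theorem IsTest.mono {Ω Ω' : Set E} {φ : E → ℝ} (h : IsTest Ω φ) (hs : Ω ⊆ Ω') : IsTest Ω' φ :=
  ⟨h.contDiff, h.compact, h.subset.trans hs⟩

theorem IsTest.differentiable {Ω : Set E} {φ : E → ℝ} (h : IsTest Ω φ) : Differentiable ℝ φ :=
  h.contDiff.differentiable (by simp)

theorem IsTest.continuous_gradient [CompleteSpace E] {Ω : Set E} {φ : E → ℝ} (h : IsTest Ω φ) :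
    Continuous (gradient φ) :=
  (InnerProductSpace.toDual ℝ E).symm.continuous.comp (h.contDiff.continuous_fderiv (by simp))

theorem gradient_eq_zero_of_notMem_tsupport [CompleteSpace E] {φ : E → ℝ} {x : E} (hx : x ∉ tsupport φ) :
    gradient φ x = 0 := by
  have : fderiv ℝ φ x = 0 := by
    by_contra h
    exact hx (support_fderiv_subset ℝ h)
  simp [gradient, this]

theorem tsupport_pow_subset {X : Type*} [TopologicalSpace X] (ψ : X → ℝ) {k : ℕ} (hk : k ≠ 0) :
    tsupport (fun x => ψ x ^ k) ⊆ tsupport ψ :=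
  closure_mono fun x hx h => hx (by simp [h, hk])

theorem IsTest.pow {Ω : Set E} {ψ : E → ℝ} (hψ : IsTest Ω ψ) {k : ℕ} (hk : k ≠ 0) :
    IsTest Ω fun x => ψ x ^ k :=
  ⟨hψ.contDiff.pow k,
    hψ.compact.of_isClosed_subset (isClosed_tsupport _) (tsupport_pow_subset ψ hk),
    (tsupport_pow_subset ψ hk).trans hψ.subset⟩

end TestFunctions

/-! ### Mollification of weak gradients and its convergence in duality pairings. -/

section Mollification

variable {E : Type*} [NormedAddCommGroup E] [InnerProductSpace ℝ E] [FiniteDimensional ℝ E]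
  [MeasurableSpace E] [BorelSpace E]

/-- The whole-space form of the weak gradient identity on `Ω`. -/
def WeakGrad (Ω : Set E) (u : E → ℝ) (g : E → E) : Prop :=
  ∀ φ, IsTest Ω φ → ∀ v, ∫ x, u x * fderiv ℝ φ x v = -∫ x, inner ℝ (g x) v * φ x

/-- The convolution of a function with a normalized bump function. -/
noncomputable def mollify {F : Type*} [NormedAddCommGroup F] [NormedSpace ℝ F]
    (ρ : ContDiffBump (0 : E)) (f : E → F) : E → F :=
  ρ.normed volume ⋆[lsmul ℝ ℝ, volume] f

theorem mollify_apply {F : Type*} [NormedAddCommGroup F] [NormedSpace ℝ F]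
    (ρ : ContDiffBump (0 : E)) (f : E → F) (x : E) :
    mollify ρ f x = ∫ y, ρ.normed volume y • f (x - y) := rfl

theorem contDiff_mollify {F : Type*} [NormedAddCommGroup F] [NormedSpace ℝ F] [CompleteSpace F]
    (ρ : ContDiffBump (0 : E)) {f : E → F} (hf : LocallyIntegrable f) :
    ContDiff ℝ ∞ (mollify ρ f) :=
  HasCompactSupport.contDiff_convolution_left _ ρ.hasCompactSupport_normed ρ.contDiff_normed hf

/-- Differentiating the kernel turns the left side into the weak gradient identity tested with y ↦
ρ(x - y). This function is supported in the closed ball around `x`, hence in `K`, so the truncation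
by the indicator is not seen. -/
theorem gradient_mollify {Ω K : Set E} {w : E → ℝ} {g : E → E} (hK : MeasurableSet K)
    (hKΩ : K ⊆ Ω) (hw : IntegrableOn w K) (hg : IntegrableOn g K) (hwg : WeakGrad Ω w g)
    (ρ : ContDiffBump (0 : E)) {x : E} (hx : closedBall x ρ.rOut ⊆ K) :
    gradient (mollify ρ (K.indicator w)) x = mollify ρ (K.indicator g) x := by
  have hwi : Integrable (K.indicator w) := (integrable_indicator_iff hK).2 hw
  have hgi : Integrable (K.indicator g) := (integrable_indicator_iff hK).2 hg
  set r : E → ℝ := ρ.normed volume with hr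
  have hrs : ContDiff ℝ ∞ r := ρ.contDiff_normed
  have hrc : HasCompactSupport r := ρ.hasCompactSupport_normed
  have hs : tsupport (fun y => r (x - y)) ⊆ closedBall x ρ.rOut := by
    apply closure_minimal _ isClosed_closedBall
    intro y hy
    have : x - y ∈ Function.support r := hy
    rw [hr, ρ.support_normed_eq] at this
    simp only [mem_ball, dist_zero_right] at this
    rw [mem_closedBall, dist_comm, dist_eq_norm]
    exact this.le
  have hφ : IsTest Ω (fun y => r (x - y)) := by
    exact ⟨hrs.comp (contDiff_const.sub contDiff_id),
      (isCompact_closedBall x ρ.rOut).of_isClosed_subset (isClosed_tsupport _) hs,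
      hs.trans (hx.trans hKΩ)⟩
  have hzero : ∀ y, y ∉ K → y ∉ tsupport (fun y => r (x - y)) := by
    intro y hy hy'
    apply hy
    apply hx
    exact hs hy'
  have hderiv : ∀ y v, fderiv ℝ (fun y => r (x - y)) y v = - fderiv ℝ r (x - y) v := by
    intro y v
    have h1 : HasFDerivAt (fun y => x - y) (-(ContinuousLinearMap.id ℝ E)) y := by
      simpa using (hasFDerivAt_id y).const_sub x
    have h2 := ((hrs.differentiable (by simp)) (x - y)).hasFDerivAt.comp y h1
    have h3 : fderiv ℝ (fun y => r (x - y)) y = _ := h2.fderiv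
    rw [h3]; simp
  apply ext_inner_right ℝ
  intro v
  rw [inner_gradient_left]
  have h1 := HasCompactSupport.hasFDerivAt_convolution_left (lsmul ℝ ℝ) (μ := volume) hrc
    (hrs.of_le (by simp)) hwi.locallyIntegrable x
  have h1' : fderiv ℝ (mollify ρ (K.indicator w)) x = _ := h1.fderiv
  rw [h1', convolution_eq_swap]
  have hint : Integrable (fun t => ((lsmul ℝ ℝ).precompL E (fderiv ℝ r (x - t)))
      (K.indicator w t)) := by
    have h4 := (HasCompactSupport.convolutionExists_left ((lsmul ℝ ℝ : ℝ →L[ℝ] ℝ →L[ℝ] ℝ).precompL E) (hrc.fderiv ℝ)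
      (hrs.continuous_fderiv (by simp)) hwi.locallyIntegrable x)
    exact (convolutionExistsAt_iff_integrable_swap).1 h4
  rw [ContinuousLinearMap.integral_apply hint]
  have h5 : ∀ t, (((lsmul ℝ ℝ).precompL E (fderiv ℝ r (x - t))) (K.indicator w t)) v
      = -(w t * fderiv ℝ (fun y => r (x - y)) t v) := by
    intro t
    by_cases ht : t ∈ K
    · simp [hderiv, ht, mul_comm, ContinuousLinearMap.precompL_apply]
    · have : fderiv ℝ (fun y => r (x - y)) t = 0 := by
        by_contra h
        exact hzero t ht (support_fderiv_subset ℝ h)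
      simp [this, ht]
  simp_rw [h5]
  rw [integral_neg, hwg _ hφ v, neg_neg]
  have h6 : mollify ρ (K.indicator g) x = ∫ t, r (x - t) • K.indicator g t := by
    rw [mollify, convolution_eq_swap]; rfl
  have h7 : Integrable fun t => r (x - t) • K.indicator g t := by
    have h4 := (HasCompactSupport.convolutionExists_left (lsmul ℝ ℝ : ℝ →L[ℝ] E →L[ℝ] E) hrc
      hrs.continuous hgi.locallyIntegrable x)
    exact (convolutionExistsAt_iff_integrable_swap).1 h4
  rw [h6, real_inner_comm, ← integral_inner h7]
  congr 1
  ext t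
  by_cases ht : t ∈ K
  · simp only [ht, indicator_of_mem, inner_smul_right]
    rw [real_inner_comm]; ring
  · have : r (x - t) = 0 :=
      image_eq_zero_of_notMem_tsupport (f := fun y => r (x - y)) (hzero t ht)
    simp [this]

/-- Hölder's inequality for the pairing of a function with a mollification. -/
theorem lintegral_enorm_mul_mollify_le {p p' : ℝ≥0∞} [ENNReal.HolderTriple p' p 1]
    {F F' : Type*} [NormedAddCommGroup F] [NormedSpace ℝ F] [NormedAddCommGroup F']
    (ρ : ContDiffBump (0 : E)) {A : E → F'} {H : E → F} (hA : AEStronglyMeasurable A)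
    (hH : AEStronglyMeasurable H) :
    ∫⁻ x, ‖A x‖ₑ * ‖mollify ρ H x‖ₑ ≤ eLpNorm A p' volume * eLpNorm H p volume := by
  set r : E → ℝ := ρ.normed volume with hr
  have hrm : Measurable r := ρ.continuous_normed.measurable
  have hmeas : AEMeasurable (Function.uncurry fun x y : E => ‖A x‖ₑ * (‖r y‖ₑ * ‖H (x - y)‖ₑ))
      ((volume : Measure E).prod volume) := by
    have h1 : AEMeasurable (fun z : E × E => ‖A z.1‖ₑ) ((volume : Measure E).prod volume) :=
      (hA.comp_fst).enorm
    have h2 : AEMeasurable (fun z : E × E => ‖r z.2‖ₑ) ((volume : Measure E).prod volume) :=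
      (hrm.comp measurable_snd).enorm.aemeasurable
    have h3 : AEMeasurable (fun z : E × E => ‖H (z.1 - z.2)‖ₑ)
        ((volume : Measure E).prod volume) :=
      (hH.comp_quasiMeasurePreserving
        (quasiMeasurePreserving_sub_of_right_invariant volume volume)).enorm
    exact h1.mul (h2.mul h3)
  calc ∫⁻ x, ‖A x‖ₑ * ‖mollify ρ H x‖ₑ
      ≤ ∫⁻ x, ∫⁻ y, ‖A x‖ₑ * (‖r y‖ₑ * ‖H (x - y)‖ₑ) := by
        refine lintegral_mono fun x => ?_
        refine le_trans ?_ (lintegral_const_mul_le _ _)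
        gcongr
        rw [mollify_apply]
        refine (enorm_integral_le_lintegral_enorm _).trans ?_
        simp_rw [enorm_smul]
        exact le_rfl
    _ = ∫⁻ y, ∫⁻ x, ‖A x‖ₑ * (‖r y‖ₑ * ‖H (x - y)‖ₑ) := lintegral_lintegral_swap hmeas
    -- For each fixed `y`, Hölder and translation invariance give a bound that does not depend on
    -- `y`; the kernel then integrates to 1.
    _ ≤ ∫⁻ y, ‖r y‖ₑ * (eLpNorm A p' volume * eLpNorm H p volume) := by
        refine lintegral_mono fun y => ?_
        have h1 : ∫⁻ x, ‖A x‖ₑ * (‖r y‖ₑ * ‖H (x - y)‖ₑ)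
            = ‖r y‖ₑ * ∫⁻ x, ‖A x‖ₑ * ‖H (x - y)‖ₑ := by
          rw [← lintegral_const_mul' _ _ enorm_ne_top]
          congr 1; ext x; ring
        rw [h1]
        gcongr
        have hmp := measurePreserving_sub_right (volume : Measure E) y
        have h2 : eLpNorm (fun x => H (x - y)) p volume = eLpNorm H p volume :=
          eLpNorm_comp_measurePreserving hH hmp
        have h3 := eLpNorm_smul_le_mul_eLpNorm (p := p') (q := p) (r := 1)
          (hH.norm.comp_measurePreserving hmp) (φ := fun x => ‖A x‖) hA.norm
        rw [eLpNorm_norm, eLpNorm_one_eq_lintegral_enorm] at h3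
        have h4 : eLpNorm ((fun x => ‖H x‖) ∘ fun x => x - y) p volume
            = eLpNorm H p volume := by
          rw [← h2]
          exact eLpNorm_norm (fun x => H (x - y))
        rw [h4] at h3
        refine le_trans (le_of_eq ?_) h3
        simp [enorm_mul]
    _ = eLpNorm A p' volume * eLpNorm H p volume := by
        rw [lintegral_mul_const _ hrm.enorm]
        have : ∫⁻ y, ‖r y‖ₑ = 1 := by
          rw [← ofReal_integral_norm_eq_lintegral_enorm ρ.integrable_normed]
          have : (fun y => ‖ρ.normed volume y‖) = ρ.normed volume := by
            ext y
            rw [Real.norm_eq_abs, abs_of_nonneg (ρ.nonneg_normed y)]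
          rw [this, ρ.integral_normed, ENNReal.ofReal_one]
        rw [this, one_mul]

theorem norm_mollify_le {F : Type*} [NormedAddCommGroup F] [NormedSpace ℝ F]
    (ρ : ContDiffBump (0 : E)) {H : E → F} {M : ℝ} (hM : ∀ x, ‖H x‖ ≤ M) (x : E) :
    ‖mollify ρ H x‖ ≤ M := by
  rw [mollify_apply]
  refine (norm_integral_le_of_norm_le (g := fun y => ρ.normed volume y * M)
    (ρ.integrable_normed.mul_const M) (Eventually.of_forall fun y => ?_)).trans ?_
  · rw [norm_smul, Real.norm_eq_abs, abs_of_nonneg (ρ.nonneg_normed y)]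
    exact mul_le_mul_of_nonneg_left (hM _) (ρ.nonneg_normed y)
  · rw [integral_mul_const, ρ.integral_normed, one_mul]

/-- Density argument: for a continuous compactly supported approximation of `H`, dominated
convergence applies; the remaining error is controlled uniformly in `n` by
`lintegral_enorm_mul_mollify_le`. Only convergence against a fixed `A` is needed later. -/
theorem tendsto_lintegral_mollify_sub {p p' : ℝ≥0∞} [ENNReal.HolderTriple p' p 1] (hp : p ≠ ⊤)
    {F F' : Type*} [NormedAddCommGroup F] [NormedSpace ℝ F] [CompleteSpace F]
    [NormedAddCommGroup F'] {ρ : ℕ → ContDiffBump (0 : E)}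
    (hρ : Tendsto (fun n => (ρ n).rOut) atTop (𝓝 0)) {A : E → F'} {H : E → F}
    (hA : MemLp A p' volume) (hA1 : Integrable A) (hH : MemLp H p volume) (hH1 : Integrable H) :
    Tendsto (fun n => ∫⁻ x, ‖A x‖ₑ * ‖mollify (ρ n) H x - H x‖ₑ) atTop (𝓝 0) := by
  rw [ENNReal.tendsto_nhds_zero]
  intro ε hε
  by_cases hεt : ε = ⊤
  · simp [hεt]
  set a := eLpNorm A p' volume with ha
  have hat : a ≠ ⊤ := hA.eLpNorm_ne_top
  -- The denominator is `a + 1` because `a` may vanish.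
  set δ : ℝ≥0∞ := ε / 3 / (a + 1) with hδ
  have hδ0 : δ ≠ 0 := by
    simp only [hδ, ne_eq, ENNReal.div_eq_zero_iff, not_or]
    exact ⟨⟨hε.ne', by simp⟩, by simp [hat]⟩
  have haδ : a * δ ≤ ε / 3 := by
    rw [hδ]
    calc a * (ε / 3 / (a + 1)) ≤ (a + 1) * (ε / 3 / (a + 1)) := by gcongr; simp
      _ ≤ ε / 3 := ENNReal.mul_div_le
  obtain ⟨H₁, hH₁c, hH₁n, hH₁cont, hH₁m⟩ := hH.exists_hasCompactSupport_eLpNorm_sub_le hp hδ0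
  have hH₁i : Integrable H₁ := hH₁cont.integrable_of_hasCompactSupport hH₁c
  obtain ⟨M, hM⟩ := hH₁cont.bounded_above_of_compact_support hH₁c
  have hlim : Tendsto (fun n => ∫⁻ x, ‖A x‖ₑ * ‖mollify (ρ n) H₁ x - H₁ x‖ₑ) atTop (𝓝 0) := by
    have h0 : (0 : ℝ≥0∞) = ∫⁻ x : E, (0 : ℝ≥0∞) := by simp
    rw [h0]
    have hM0 : 0 ≤ M := (norm_nonneg _).trans (hM 0)
    refine tendsto_lintegral_of_dominated_convergence' (fun x => ‖A x‖ₑ * ENNReal.ofReal (2 * M))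
      (fun n => ?_) (fun n => Eventually.of_forall fun x => ?_) ?_
      (Eventually.of_forall fun x => ?_)
    · exact hA.1.enorm.mul
        (((contDiff_mollify (ρ n) hH₁i.locallyIntegrable).continuous.sub
          hH₁cont).enorm.measurable.aemeasurable)
    · simp only
      gcongr
      rw [← ofReal_norm]
      apply ENNReal.ofReal_le_ofReal
      calc _ ≤ ‖mollify (ρ n) H₁ x‖ + ‖H₁ x‖ := norm_sub_le _ _
        _ ≤ 2 * M := by linarith [hM x, norm_mollify_le (ρ n) hM x]
    · rw [lintegral_mul_const'' _ hA.1.enorm]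
      exact ENNReal.mul_ne_top hA1.2.ne ENNReal.ofReal_ne_top
    · have h1 : Tendsto (fun n => mollify (ρ n) H₁ x) atTop (𝓝 (H₁ x)) :=
        ContDiffBump.convolution_tendsto_right_of_continuous hρ hH₁cont x
      have h2 : Tendsto (fun n => ‖mollify (ρ n) H₁ x - H₁ x‖ₑ) atTop (𝓝 0) := by
        have := (h1.sub_const (H₁ x)).enorm
        simpa using this
      simpa using ENNReal.Tendsto.const_mul h2 (Or.inr enorm_ne_top)
  have hsub : Integrable (H - H₁) := hH1.sub hH₁i
  filter_upwards [ENNReal.tendsto_nhds_zero.1 hlim (ε / 3)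
    (ENNReal.div_pos hε.ne' (by simp))] with n hn
  have hlin : ∀ x, mollify (ρ n) H x = mollify (ρ n) (H - H₁) x + mollify (ρ n) H₁ x := by
    intro x
    have hex : ∀ f : E → F, Integrable f →
        Integrable (fun y => (ρ n).normed volume y • f (x - y)) := fun f hf =>
      HasCompactSupport.convolutionExists_left (lsmul ℝ ℝ : ℝ →L[ℝ] F →L[ℝ] F)
        (ρ n).hasCompactSupport_normed (ρ n).continuous_normed hf.locallyIntegrable x
    simp only [mollify_apply]
    rw [← integral_add (hex _ hsub) (hex _ hH₁i)]
    congr 1; ext y; simp [smul_sub]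
  calc ∫⁻ x, ‖A x‖ₑ * ‖mollify (ρ n) H x - H x‖ₑ
      ≤ ∫⁻ x, ((‖A x‖ₑ * ‖mollify (ρ n) (H - H₁) x‖ₑ
          + ‖A x‖ₑ * ‖mollify (ρ n) H₁ x - H₁ x‖ₑ) + ‖A x‖ₑ * ‖(H - H₁) x‖ₑ) := by
        refine lintegral_mono fun x => ?_
        rw [← mul_add, ← mul_add]
        gcongr
        have : mollify (ρ n) H x - H x
            = mollify (ρ n) (H - H₁) x + (mollify (ρ n) H₁ x - H₁ x) - (H - H₁) x := by
          rw [hlin x]; simp; abel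
        rw [this]
        exact (enorm_sub_le).trans (add_le_add_left (enorm_add_le _ _) _)
    _ = (∫⁻ x, ‖A x‖ₑ * ‖mollify (ρ n) (H - H₁) x‖ₑ)
          + (∫⁻ x, ‖A x‖ₑ * ‖mollify (ρ n) H₁ x - H₁ x‖ₑ) + ∫⁻ x, ‖A x‖ₑ * ‖(H - H₁) x‖ₑ := by
        have hm1 : AEMeasurable (fun x => ‖A x‖ₑ * ‖mollify (ρ n) (H - H₁) x‖ₑ) :=
          hA.1.enorm.mul ((contDiff_mollify (ρ n)
            hsub.locallyIntegrable).continuous.enorm.measurable.aemeasurable)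
        rw [lintegral_add_right' (g := fun x => ‖A x‖ₑ * ‖(H - H₁) x‖ₑ) _
          (hA.1.enorm.mul hsub.1.enorm), lintegral_add_left' hm1]
    _ ≤ ε / 3 + ε / 3 + ε / 3 := by
        refine add_le_add (add_le_add ?_ hn) ?_
        · refine (lintegral_enorm_mul_mollify_le (p := p) (p' := p') (ρ n) hA.1 hsub.1).trans ?_
          exact (mul_le_mul_right hH₁n _).trans haδ
        · have h3 := eLpNorm_smul_le_mul_eLpNorm (p := p') (q := p) (r := 1) (μ := volume)
            (f := fun x => ‖(H - H₁) x‖) hsub.1.norm (φ := fun x => ‖A x‖) hA.1.norm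
          rw [eLpNorm_norm, eLpNorm_norm, eLpNorm_one_eq_lintegral_enorm] at h3
          refine le_trans (le_of_eq ?_) (h3.trans ((mul_le_mul_right hH₁n _).trans haδ))
          simp [enorm_mul]
    _ = ε := ENNReal.add_thirds ε

end Mollification

/-! ### Testing a weak equation with nonlinear functions of a Sobolev function. -/

section NonlinearTest

variable {E : Type*} [NormedAddCommGroup E] [InnerProductSpace ℝ E] [FiniteDimensional ℝ E]
  [MeasurableSpace E] [BorelSpace E]

/-- A weak equation `-div A = h` may be tested with `ψ · F(w)`, where `ψ` is a test function,
`F` is smooth and `w` is continuous with weak gradient `G` in `L^p_loc`. -/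
theorem weak_equation_test_comp {p p' : ℝ≥0∞} [ENNReal.HolderTriple p' p 1] (hp : p ≠ ⊤)
    (hp1 : 1 ≤ p) (hp1' : 1 ≤ p')
    {Ω : Set E} (hΩ : IsOpen Ω) {w h : E → ℝ} {G A : E → E} (hw : ContinuousOn w Ω)
    (hG : ∀ K, IsCompact K → K ⊆ Ω → MemLp G p (volume.restrict K))
    (hA : ∀ K, IsCompact K → K ⊆ Ω → MemLp A p' (volume.restrict K))
    (hh : ContinuousOn h Ω) (hwG : WeakGrad Ω w G)
    (heq : ∀ φ, IsTest Ω φ → ∫ x, inner ℝ (A x) (gradient φ x) = ∫ x, h x * φ x)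
    {F : ℝ → ℝ} (hF : ContDiff ℝ ∞ F) {ψ : E → ℝ} (hψ : IsTest Ω ψ) :
    Integrable (fun x =>
      inner ℝ (A x) (F (w x) • gradient ψ x + (ψ x * deriv F (w x)) • G x)) ∧
    ∫ x, inner ℝ (A x) (F (w x) • gradient ψ x + (ψ x * deriv F (w x)) • G x)
      = ∫ x, h x * (ψ x * F (w x)) := by
  set K := tsupport ψ with hKdef
  have hK : IsCompact K := hψ.compact
  -- The δ-thickening leaves room for kernels of radius at most δ: on `K`, mollifications of `w` and
  -- `G` use only their values on `K'`.
  obtain ⟨δ, hδ, hδΩ⟩ := hK.exists_cthickening_subset_open hΩ hψ.subset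
  set K' := cthickening δ K with hK'def
  have hK' : IsCompact K' := hK.cthickening
  have hKK' : K ⊆ K' := self_subset_cthickening K
  have hKm : MeasurableSet K := hK.measurableSet
  have hKm' : MeasurableSet K' := hK'.measurableSet
  have : IsFiniteMeasure (volume.restrict K) := ⟨by simpa using hK.measure_lt_top⟩
  have : IsFiniteMeasure (volume.restrict K') := ⟨by simpa using hK'.measure_lt_top⟩
  set w' := K'.indicator w with hw'
  set G' := K'.indicator G with hG'
  set A' := K.indicator A with hA'
  set h' := K.indicator h with hh'
  have hwK' : IntegrableOn w K' := (hw.mono hδΩ).integrableOn_compact hK'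
  have hGK' : IntegrableOn G K' := (hG K' hK' hδΩ).integrable hp1
  have hw'i : Integrable w' := (integrable_indicator_iff hKm').2 hwK'
  have hG'i : Integrable G' := (integrable_indicator_iff hKm').2 hGK'
  have hG'm : MemLp G' p volume := (memLp_indicator_iff_restrict hKm').2 (hG K' hK' hδΩ)
  have hA'm : MemLp A' p' volume :=
    (memLp_indicator_iff_restrict hKm).2 (hA K hK hψ.subset)
  have hA'i : Integrable A' :=
    (integrable_indicator_iff hKm).2 ((hA K hK hψ.subset).integrable hp1')
  have hh'i : Integrable h' :=
    (integrable_indicator_iff hKm).2 ((hh.mono hψ.subset).integrableOn_compact hK)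
  have hAG : Integrable (fun x => ‖A' x‖ * ‖G' x‖) :=
    memLp_one_iff_integrable.1 (hG'm.norm.smul hA'm.norm)
  let ρ : ℕ → ContDiffBump (0 : E) := fun n =>
    ⟨δ / (n + 3), δ / (n + 2), by positivity, by gcongr; norm_num⟩
  have hρ : Tendsto (fun n => (ρ n).rOut) atTop (𝓝 0) := by
    have := (tendsto_const_div_atTop_nhds_zero_nat δ).comp (tendsto_add_atTop_nat 2)
    refine this.congr fun n => ?_
    simp [ρ]
  have hρδ : ∀ n, (ρ n).rOut ≤ δ := fun n => div_le_self hδ.le (by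
    have : (0 : ℝ) ≤ n := n.cast_nonneg
    linarith)
  let wn : ℕ → E → ℝ := fun n => mollify (ρ n) w'
  have hwn : ∀ n, ContDiff ℝ ∞ (wn n) := fun n => contDiff_mollify _ hw'i.locallyIntegrable
  let φ : ℕ → E → ℝ := fun n x => ψ x * F (wn n x)
  have hφ : ∀ n, IsTest Ω (φ n) := fun n =>
    have hs : tsupport (φ n) ⊆ K := closure_mono (Function.support_mul_subset_left _ _)
    ⟨hψ.contDiff.mul (hF.comp (hwn n)), hψ.compact.mul_right, hs.trans hψ.subset⟩
  have hgradn : ∀ n, ∀ x ∈ K, gradient (wn n) x = mollify (ρ n) G' x := by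
    intro n x hx
    refine gradient_mollify hKm' hδΩ hwK' hGK' hwG (ρ n) ?_
    exact (closedBall_subset_closedBall (hρδ n)).trans
      (closedBall_subset_cthickening hx δ)
  have hgradφ : ∀ n x, gradient (φ n) x
      = F (wn n x) • gradient ψ x + (ψ x * deriv F (wn n x)) • gradient (wn n) x := by
    intro n x
    apply ext_inner_right ℝ
    intro v
    simp only [inner_add_left, inner_smul_left, inner_gradient_left]
    have h1 := (hψ.differentiable x).hasFDerivAt
    have h2 := ((hwn n).differentiable (by simp) x).hasFDerivAt
    have h3 := ((hF.differentiable (by simp)) (wn n x)).hasDerivAt.comp_hasFDerivAt x h2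
    have h4 : fderiv ℝ (φ n) x = _ := (h1.mul h3).fderiv
    rw [h4]
    simp; ring
  have hlimw : ∀ x ∈ K, Tendsto (fun n => wn n x) atTop (𝓝 (w' x)) := by
    intro x hx
    have hnx : K' ∈ 𝓝 x :=
      mem_of_superset (isOpen_thickening.mem_nhds (self_subset_thickening hδ K hx))
        (thickening_subset_cthickening δ K)
    have hcx : Tendsto w' (𝓝 x) (𝓝 (w' x)) := by
      have h1 : ContinuousAt w x := hw.continuousAt (hΩ.mem_nhds (hψ.subset hx))
      have h2 : w' =ᶠ[𝓝 x] w := by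
        filter_upwards [hnx] with y hy using indicator_of_mem hy _
      exact h1.congr h2.symm
    exact ContDiffBump.convolution_tendsto_right (g := fun _ => w') (k := fun _ => x) hρ
      (Eventually.of_forall fun _ => hw'i.1) (hcx.comp tendsto_snd) tendsto_const_nhds
  obtain ⟨M, hM⟩ : ∃ M, ∀ x, ‖w' x‖ ≤ M := by
    obtain ⟨M, hM⟩ := hK'.exists_bound_of_continuousOn (hw.mono hδΩ)
    refine ⟨max M 0, fun x => ?_⟩
    by_cases hx : x ∈ K'
    · rw [hw', indicator_of_mem hx]; exact (hM x hx).trans (le_max_left _ _)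
    · rw [hw', indicator_of_notMem hx]; simp
  have hwnM : ∀ n x, ‖wn n x‖ ≤ M := fun n x => norm_mollify_le (ρ n) hM x
  have hdF : Continuous (deriv F) := hF.continuous_deriv (by simp)
  obtain ⟨C₁, hC₁⟩ := (isCompact_Icc (a := -M) (b := M)).exists_bound_of_continuousOn
    hF.continuous.continuousOn
  obtain ⟨C₂, hC₂⟩ := (isCompact_Icc (a := -M) (b := M)).exists_bound_of_continuousOn
    hdF.continuousOn
  obtain ⟨C₃, hC₃⟩ := hψ.contDiff.continuous.bounded_above_of_compact_support hψ.compact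
  obtain ⟨C₄, hC₄⟩ := hψ.continuous_gradient.bounded_above_of_compact_support
    (HasCompactSupport.of_support_subset_isCompact hK fun x hx => by
      by_contra hxK
      exact hx (gradient_eq_zero_of_notMem_tsupport hxK))
  have hIcc : ∀ n x, wn n x ∈ Icc (-M) M := fun n x => abs_le.1 (hwnM n x)
  have hM0 : 0 ≤ M := (norm_nonneg _).trans (hM 0)
  have hC₁0 : 0 ≤ C₁ := (norm_nonneg _).trans (hC₁ 0 ⟨by linarith, hM0⟩)
  have hC₂0 : 0 ≤ C₂ := (norm_nonneg _).trans (hC₂ 0 ⟨by linarith, hM0⟩)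
  have hC₃0 : 0 ≤ C₃ := (norm_nonneg _).trans (hC₃ 0)
  have hC₄0 : 0 ≤ C₄ := (norm_nonneg _).trans (hC₄ 0)
  have hoff : ∀ x, x ∉ K → ψ x = 0 ∧ gradient ψ x = 0 := fun x hx =>
    ⟨image_eq_zero_of_notMem_tsupport hx, gradient_eq_zero_of_notMem_tsupport hx⟩
  -- The integrand for the mollified test function is split as `T (wn n) + S n`. In `T` only the
  -- arguments of `F` and `deriv F` are mollified, and the gradient is the true one, so pointwise
  -- convergence and a fixed dominating function suffice.
  let T : (E → ℝ) → E → ℝ := fun v x =>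
    inner ℝ (A' x) (F (v x) • gradient ψ x + (ψ x * deriv F (v x)) • G' x)
  have hTmeas : ∀ v : E → ℝ, AEStronglyMeasurable v → AEStronglyMeasurable (T v) := by
    intro v hv
    refine hA'i.1.inner (((hF.continuous.comp_aestronglyMeasurable hv).smul
      hψ.continuous_gradient.aestronglyMeasurable).add
      ((hψ.contDiff.continuous.aestronglyMeasurable.mul
        (hdF.comp_aestronglyMeasurable hv)).smul hG'i.1))
  let D : E → ℝ := fun x => C₁ * C₄ * ‖A' x‖ + C₃ * C₂ * (‖A' x‖ * ‖G' x‖)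
  have hD : Integrable D := (hA'i.norm.const_mul _).add (hAG.const_mul _)
  have hTbound : ∀ v : E → ℝ, (∀ x, ‖v x‖ ≤ M) → ∀ x, ‖T v x‖ ≤ D x := by
    intro v hv x
    have hvx : v x ∈ Icc (-M) M := abs_le.1 (hv x)
    calc ‖T v x‖ ≤ ‖A' x‖ * ‖F (v x) • gradient ψ x + (ψ x * deriv F (v x)) • G' x‖ :=
          norm_inner_le_norm _ _
      _ ≤ ‖A' x‖ * (C₁ * C₄ + C₃ * C₂ * ‖G' x‖) := by
          gcongr
          refine (norm_add_le _ _).trans ?_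
          rw [norm_smul, norm_smul, norm_mul]
          gcongr
          · exact hC₁ _ hvx
          · exact hC₄ x
          · exact hC₃ x
          · exact hC₂ _ hvx
      _ = D x := by simp only [D]; ring
  have hTint : ∀ v : E → ℝ, AEStronglyMeasurable v → (∀ x, ‖v x‖ ≤ M) → Integrable (T v) :=
    fun v hv hvM => hD.mono' (hTmeas v hv) (Eventually.of_forall (hTbound v hvM))
  have hwnm : ∀ n, AEStronglyMeasurable (wn n) := fun n =>
    (hwn n).continuous.aestronglyMeasurable
  have hTeq : (fun x => inner ℝ (A x) (F (w x) • gradient ψ x + (ψ x * deriv F (w x)) • G x))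
      = T w' := by
    ext x
    by_cases hx : x ∈ K
    · simp [T, hA', hG', hw', hx, hKK' hx]
    · simp [T, hoff x hx]
  have hlim1 : Tendsto (fun n => ∫ x, T (wn n) x) atTop (𝓝 (∫ x, T w' x)) := by
    refine tendsto_integral_of_dominated_convergence D (fun n => hTmeas _ (hwnm n)) hD
      (fun n => Eventually.of_forall (hTbound _ (hwnM n))) (Eventually.of_forall fun x => ?_)
    by_cases hx : x ∈ K
    · have h1 := hlimw x hx
      have h2 := (hF.continuous.tendsto (w' x)).comp h1
      have h3 := (hdF.tendsto (w' x)).comp h1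
      exact tendsto_const_nhds.inner ((h2.smul_const _).add ((h3.const_mul _).smul_const _))
    · simp only [T, hoff x hx]
      simp
  -- The remainder carries the error of the mollified gradient. It has no pointwise limit in
  -- general, but tends to 0 in L¹ by the pairing of L^p' with L^p.
  let S : ℕ → E → ℝ := fun n x =>
    inner ℝ (A' x) ((ψ x * deriv F (wn n x)) • (mollify (ρ n) G' x - G' x))
  have hSbound : ∀ n x, ‖S n x‖ₑ
      ≤ ENNReal.ofReal (C₃ * C₂) * (‖A' x‖ₑ * ‖mollify (ρ n) G' x - G' x‖ₑ) := by
    intro n x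
    rw [← ofReal_norm, ← ofReal_norm, ← ofReal_norm,
      ← ENNReal.ofReal_mul (norm_nonneg _), ← ENNReal.ofReal_mul (by positivity)]
    apply ENNReal.ofReal_le_ofReal
    refine (norm_inner_le_norm _ _).trans ?_
    rw [norm_smul, norm_mul]
    have h1 : ‖ψ x‖ * ‖deriv F (wn n x)‖ ≤ C₃ * C₂ :=
      mul_le_mul (hC₃ x) (hC₂ _ (hIcc n x)) (norm_nonneg _) hC₃0
    calc _ = (‖ψ x‖ * ‖deriv F (wn n x)‖) * (‖A' x‖ * ‖mollify (ρ n) G' x - G' x‖) := by ring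
      _ ≤ _ := by gcongr
  have hL := tendsto_lintegral_mollify_sub (p := p) (p' := p') hp hρ hA'm hA'i hG'm hG'i
  have hS0 : Tendsto (fun n => ∫⁻ x, ‖S n x‖ₑ) atTop (𝓝 0) := by
    refine tendsto_of_tendsto_of_tendsto_of_le_of_le tendsto_const_nhds
      (h := fun n => ENNReal.ofReal (C₃ * C₂)
        * ∫⁻ x, ‖A' x‖ₑ * ‖mollify (ρ n) G' x - G' x‖ₑ) ?_ (fun _ => bot_le) ?_
    · simpa using ENNReal.Tendsto.const_mul hL (Or.inr ENNReal.ofReal_ne_top)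
    · intro n
      simp only
      rw [← lintegral_const_mul' _ _ ENNReal.ofReal_ne_top]
      exact lintegral_mono (hSbound n)
  have hSmeas : ∀ n, AEStronglyMeasurable (S n) := fun n =>
    hA'i.1.inner ((hψ.contDiff.continuous.aestronglyMeasurable.mul
        (hdF.comp_aestronglyMeasurable (hwnm n))).smul
      ((contDiff_mollify (ρ n) hG'i.locallyIntegrable).continuous.aestronglyMeasurable.sub
        hG'i.1))
  have hSint : ∀ᶠ n in atTop, Integrable (S n) := by
    filter_upwards [(ENNReal.tendsto_nhds_zero.1 hS0) 1 one_pos] with n hn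
    exact ⟨hSmeas n, hn.trans_lt ENNReal.one_lt_top⟩
  have hlim2 : Tendsto (fun n => ∫ x, S n x) atTop (𝓝 0) := by
    have := tendsto_integral_of_L1 (fun _ : E => (0 : ℝ)) aestronglyMeasurable_const hSint
      (by simpa using hS0)
    simpa using this
  have hsplit : ∀ n x, inner ℝ (A x) (gradient (φ n) x) = T (wn n) x + S n x := by
    intro n x
    rw [hgradφ]
    by_cases hx : x ∈ K
    · rw [hgradn n x hx]
      simp only [T, S, hA', indicator_of_mem hx, inner_add_right, inner_smul_right,
        inner_sub_right]
      ring
    · simp [T, S, hoff x hx]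
  have hlim3 : Tendsto (fun n => ∫ x, h x * φ n x) atTop
      (𝓝 (∫ x, h x * (ψ x * F (w x)))) := by
    have e1 : ∀ n, (fun x => h x * φ n x) = fun x => h' x * (ψ x * F (wn n x)) := by
      intro n; ext x
      by_cases hx : x ∈ K
      · simp [φ, hh', hx]
      · simp [φ, hoff x hx]
    have e2 : (fun x => h x * (ψ x * F (w x))) = fun x => h' x * (ψ x * F (w' x)) := by
      ext x
      by_cases hx : x ∈ K
      · simp [hh', hw', hx, hKK' hx]
      · simp [hoff x hx]
    simp_rw [e1]
    rw [e2]
    refine tendsto_integral_of_dominated_convergence (fun x => C₃ * C₁ * ‖h' x‖) (fun n => ?_)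
      (hh'i.norm.const_mul _) (fun n => Eventually.of_forall fun x => ?_)
      (Eventually.of_forall fun x => ?_)
    · exact hh'i.1.mul (hψ.contDiff.continuous.mul
        (hF.continuous.comp (hwn n).continuous)).aestronglyMeasurable
    · rw [norm_mul, norm_mul, mul_comm]
      gcongr
      · exact hC₃ x
      · exact hC₁ _ (hIcc n x)
    · by_cases hx : x ∈ K
      · exact (((hF.continuous.tendsto (w' x)).comp (hlimw x hx)).const_mul _).const_mul _
      · simp only [hoff x hx]
        simp
  rw [hTeq]
  refine ⟨hTint w' hw'i.1 hM, ?_⟩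
  refine tendsto_nhds_unique ?_ hlim3
  have h4 := hlim1.add hlim2
  rw [add_zero] at h4
  refine h4.congr' ?_
  filter_upwards [hSint] with n hn
  rw [← integral_add (hTint _ (hwnm n) (hwnM n)) hn, ← heq _ (hφ n)]
  exact integral_congr_ae (Eventually.of_forall fun x => (hsplit n x).symm)

end NonlinearTest

/-! ### Monotonicity of the p-Laplacian flux, and weak comparison. -/

section Comparison

variable {E : Type*} [NormedAddCommGroup E] [InnerProductSpace ℝ E]

/-- The flux `|ξ|^{p-2} ξ` of the `p`-Laplacian. -/
noncomputable def flux (p : ℝ) (ξ : E) : E := (‖ξ‖ ^ (p - 2)) • ξ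

theorem norm_flux {p : ℝ} (hp : 1 < p) (ξ : E) : ‖flux p ξ‖ = ‖ξ‖ ^ (p - 1) := by
  rw [flux, norm_smul, Real.norm_eq_abs, abs_of_nonneg (by positivity)]
  rcases eq_or_ne ξ 0 with rfl | h
  · simp [Real.zero_rpow (by linarith : p - 1 ≠ 0)]
  · have : 0 < ‖ξ‖ := norm_pos_iff.2 h
    rw [show p - 1 = p - 2 + 1 by ring, Real.rpow_add_one this.ne']

theorem inner_flux_self {p : ℝ} (hp : 1 < p) (ξ : E) : inner ℝ (flux p ξ) ξ = ‖ξ‖ ^ p := by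
  rw [flux, real_inner_smul_left, real_inner_self_eq_norm_sq]
  rcases eq_or_ne ξ 0 with rfl | h
  · simp [Real.zero_rpow (by linarith : p ≠ 0)]
  · have : 0 < ‖ξ‖ := norm_pos_iff.2 h
    rw [← Real.rpow_natCast, ← Real.rpow_add this]
    norm_num

/-- By Cauchy–Schwarz the pairing is at least (‖a‖^(p-1) - ‖b‖^(p-1))(‖a‖ - ‖b‖), a product of
factors of equal sign. -/
theorem inner_flux_sub_nonneg {p : ℝ} (hp : 1 < p) (a b : E) :
    0 ≤ inner ℝ (flux p a - flux p b) (a - b) := by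
  have h1 : inner ℝ (flux p a) b ≤ ‖a‖ ^ (p - 1) * ‖b‖ := by
    rw [← norm_flux hp]; exact real_inner_le_norm _ _
  have h2 : inner ℝ (flux p b) a ≤ ‖b‖ ^ (p - 1) * ‖a‖ := by
    rw [← norm_flux hp]; exact real_inner_le_norm _ _
  have hpow : ∀ x : E, ‖x‖ ^ p = ‖x‖ ^ (p - 1) * ‖x‖ := by
    intro x
    rcases eq_or_ne x 0 with rfl | h
    · simp [Real.zero_rpow (by linarith : p ≠ 0)]
    · rw [← Real.rpow_add_one (norm_pos_iff.2 h).ne']; ring_nf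
  have h3 : 0 ≤ (‖a‖ ^ (p - 1) - ‖b‖ ^ (p - 1)) * (‖a‖ - ‖b‖) := by
    rcases le_total ‖a‖ ‖b‖ with h | h
    · exact mul_nonneg_of_nonpos_of_nonpos
        (sub_nonpos.2 (Real.rpow_le_rpow (norm_nonneg _) h (by linarith))) (sub_nonpos.2 h)
    · exact mul_nonneg
        (sub_nonneg.2 (Real.rpow_le_rpow (norm_nonneg _) h (by linarith))) (sub_nonneg.2 h)
  simp only [inner_sub_left, inner_sub_right, inner_flux_self hp, hpow]
  nlinarith

theorem memLp_flux {α : Type*} [MeasurableSpace α] {μ : Measure α} {p : ℝ} (hp : 1 < p)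
    {g : α → E} (hg : MemLp g (ENNReal.ofReal p) μ) :
    MemLp (fun x => flux p (g x)) (ENNReal.ofReal (p / (p - 1))) μ := by
  have h := hg.norm_rpow_div (ENNReal.ofReal (p - 1))
  rw [← ENNReal.ofReal_div_of_pos (by linarith), ENNReal.toReal_ofReal (by linarith)] at h
  refine h.mono' ?_ (Eventually.of_forall fun x => (norm_flux hp _).le)
  exact (hg.1.norm.aemeasurable.pow_const (p - 2)).aestronglyMeasurable.smul hg.1

/-- A function continuous on `Ω` multiplied by a continuous function with support in `Ω`
is globally continuous. -/
theorem continuous_mul_of_tsupport_subset {X : Type*} [TopologicalSpace X] {Ω : Set X}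
    (hΩ : IsOpen Ω) {c k : X → ℝ} (hc : ContinuousOn c Ω) (hk : Continuous k)
    (hs : tsupport k ⊆ Ω) : Continuous fun x => c x * k x :=
  (hc.mul hk.continuousOn).continuous_of_tsupport_subset hΩ
    ((closure_mono (Function.support_mul_subset_right _ _)).trans hs)

theorem IsTest.continuous_fderiv_apply {Ω : Set E} {φ : E → ℝ} (h : IsTest Ω φ) (v : E) :
    Continuous (fun x => fderiv ℝ φ x v) ∧ HasCompactSupport (fun x => fderiv ℝ φ x v) ∧
      tsupport (fun x => fderiv ℝ φ x v) ⊆ Ω := by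
  have hs : tsupport (fun x => fderiv ℝ φ x v) ⊆ tsupport φ :=
    closure_minimal (fun x hx => support_fderiv_subset ℝ fun h0 => hx (by simp [h0]))
      (isClosed_tsupport _)
  exact ⟨(h.contDiff.continuous_fderiv (by simp)).clm_apply continuous_const,
    h.compact.of_isClosed_subset (isClosed_tsupport _) hs, hs.trans h.subset⟩

variable [FiniteDimensional ℝ E]

theorem exists_isTest_eq_one_nhds {Ω K : Set E} (hΩ : IsOpen Ω) (hK : IsCompact K)
    (hKΩ : K ⊆ Ω) : ∃ ψ : E → ℝ, IsTest Ω ψ ∧ (∀ x, 0 ≤ ψ x) ∧ ∀ x ∈ K, ψ =ᶠ[𝓝 x] fun _ => 1 := by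
  obtain ⟨K', hK', hKK', hK'Ω⟩ := exists_compact_between hK hΩ hKΩ
  obtain ⟨f, hf0, hf1, hf⟩ := exists_contMDiffMap_zero_one_nhds_of_isClosed (n := ⊤)
    (modelWithCornersSelf ℝ E) isOpen_interior.isClosed_compl hK.isClosed
    (disjoint_compl_left_iff_subset.2 hKK')
  have hs : tsupport f ⊆ K' := by
    refine closure_minimal (fun x hx => ?_) hK'.isClosed
    by_contra hxK
    exact hx (hf0.self_of_nhdsSet x fun h => hxK (interior_subset h))
  exact ⟨f, ⟨f.contMDiff.contDiff, hK'.of_isClosed_subset (isClosed_tsupport _) hs,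
    hs.trans hK'Ω⟩, fun x => (hf x).1, fun x hx => mem_nhdsSet_iff_forall.1 hf1 x hx⟩

variable [MeasurableSpace E] [BorelSpace E]

theorem integrable_mul_isTest {Ω : Set E} (hΩ : IsOpen Ω) {c k : E → ℝ} (hc : ContinuousOn c Ω)
    (hk : Continuous k) (hkc : HasCompactSupport k) (hs : tsupport k ⊆ Ω) :
    Integrable fun x => c x * k x :=
  (continuous_mul_of_tsupport_subset hΩ hc hk hs).integrable_of_hasCompactSupport hkc.mul_left

/-- The weak derivative of a `C¹` function is its classical derivative. -/
theorem integral_mul_fderiv_isTest {Ω : Set E} (hΩ : IsOpen Ω) {f : E → ℝ} {f' : E → E →L[ℝ] ℝ}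
    (hf : ∀ x ∈ Ω, HasFDerivAt f (f' x) x) {v : E} (hf' : ContinuousOn (fun x => f' x v) Ω)
    {φ : E → ℝ} (hφ : IsTest Ω φ) :
    ∫ x, f x * fderiv ℝ φ x v = -∫ x, f' x v * φ x := by
  have hfc : ContinuousOn f Ω := fun x hx => (hf x hx).continuousAt.continuousWithinAt
  obtain ⟨h1, h2, h3⟩ := hφ.continuous_fderiv_apply v
  exact integral_bilinear_hasFDerivAt_right_eq_neg_left_of_integrable
    (B := ContinuousLinearMap.mul ℝ ℝ)
    (integrable_mul_isTest hΩ hf' hφ.contDiff.continuous hφ.compact hφ.subset)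
    (integrable_mul_isTest hΩ hfc h1 h2 h3)
    (integrable_mul_isTest hΩ hfc hφ.contDiff.continuous hφ.compact hφ.subset)
    (fun x hx => hf x (hφ.subset hx)) (fun x _ => (hφ.differentiable x).hasFDerivAt)

theorem weakGrad_of_hasGradientAt {Ω : Set E} (hΩ : IsOpen Ω) {f : E → ℝ} {g : E → E}
    (hf : ∀ x ∈ Ω, HasGradientAt f (g x) x) (hg : ContinuousOn g Ω) : WeakGrad Ω f g := by
  intro φ hφ v
  have h := integral_mul_fderiv_isTest hΩ (v := v) (fun x hx => (hf x hx).hasFDerivAt)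
    (by simpa using hg.inner continuousOn_const) hφ
  simpa using h

theorem integrable_inner_of_isCompact {Ω : Set E} {A Φ : E → E}
    (hA : ∀ K, IsCompact K → K ⊆ Ω → IntegrableOn A K) (hΦ : Continuous Φ)
    {K : Set E} (hK : IsCompact K) (hKΩ : K ⊆ Ω) (h0 : ∀ x, x ∉ K → Φ x = 0) :
    Integrable fun x => inner ℝ (A x) (Φ x) := by
  have h1 : IntegrableOn (fun x => inner ℝ (A x) (Φ x)) K := by
    obtain ⟨C, hC⟩ := hK.exists_bound_of_continuousOn hΦ.continuousOn
    refine ((hA K hK hKΩ).norm.const_mul C).mono'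
      ((hA K hK hKΩ).1.inner hΦ.aestronglyMeasurable) ?_
    filter_upwards [ae_restrict_mem hK.measurableSet] with x hx
    refine (norm_inner_le_norm _ _).trans ?_
    rw [mul_comm]
    gcongr
    exact hC x hx
  refine (integrableOn_iff_integrable_of_support_subset fun x hx => ?_).1 h1
  by_contra hxK
  exact hx (by simp [h0 x hxK])

theorem WeakGrad.sub {Ω : Set E} (hΩ : IsOpen Ω) {u v : E → ℝ} {g k : E → E}
    (hu : ContinuousOn u Ω) (hv : ContinuousOn v Ω)
    (hgi : ∀ K, IsCompact K → K ⊆ Ω → IntegrableOn g K)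
    (hki : ∀ K, IsCompact K → K ⊆ Ω → IntegrableOn k K)
    (hg : WeakGrad Ω u g) (hk : WeakGrad Ω v k) :
    WeakGrad Ω (fun x => u x - v x) (fun x => g x - k x) := by
  intro φ hφ e
  obtain ⟨h1, h2, h3⟩ := hφ.continuous_fderiv_apply e
  have hi : ∀ l : E → E, (∀ K, IsCompact K → K ⊆ Ω → IntegrableOn l K) →
      Integrable fun x => inner ℝ (l x) e * φ x := by
    intro l hl
    have := integrable_inner_of_isCompact hl (Φ := fun x => φ x • e)
      (hφ.contDiff.continuous.smul continuous_const) hφ.compact hφ.subset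
      (fun x hx => by simp [image_eq_zero_of_notMem_tsupport hx])
    simpa [inner_smul_right, mul_comm] using this
  simp only [sub_mul, inner_sub_left]
  rw [integral_sub (integrable_mul_isTest hΩ hu h1 h2 h3) (integrable_mul_isTest hΩ hv h1 h2 h3),
    integral_sub (hi g hgi) (hi k hki), hg φ hφ e, hk φ hφ e]
  ring

/-- A weak form of `u` being a continuous solution of `-Δ_p u = h` in `Ω` with weak
gradient `g`. -/
structure IsWeakSol (p : ℝ) (Ω : Set E) (u : E → ℝ) (g : E → E) (h : E → ℝ) : Prop where
  continuousOn : ContinuousOn u Ω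
  memLp : ∀ K, IsCompact K → K ⊆ Ω → MemLp g (ENNReal.ofReal p) (volume.restrict K)
  weakGrad : WeakGrad Ω u g
  continuousOn_rhs : ContinuousOn h Ω
  integral_eq : ∀ φ, IsTest Ω φ →
    ∫ x, inner ℝ (flux p (g x)) (gradient φ x) = ∫ x, h x * φ x

theorem IsWeakSol.mono {p : ℝ} {Ω Ω' : Set E} {u h : E → ℝ} {g : E → E}
    (H : IsWeakSol p Ω u g h) (hs : Ω' ⊆ Ω) : IsWeakSol p Ω' u g h :=
  ⟨H.continuousOn.mono hs, fun K hK hKs => H.memLp K hK (hKs.trans hs),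
    fun φ hφ => H.weakGrad φ (hφ.mono hs), H.continuousOn_rhs.mono hs,
    fun φ hφ => H.integral_eq φ (hφ.mono hs)⟩

theorem holderTriple_ofReal {p : ℝ} (hp : 1 < p) :
    ENNReal.HolderTriple (ENNReal.ofReal (p / (p - 1))) (ENNReal.ofReal p) 1 :=
  (Real.HolderConjugate.conjExponent hp).symm.ennrealOfReal

theorem one_le_ofReal_conj {p : ℝ} (hp : 1 < p) : 1 ≤ ENNReal.ofReal (p / (p - 1)) := by
  rw [ENNReal.one_le_ofReal, le_div_iff₀ (by linarith)]
  linarith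

theorem IsWeakSol.memLp_flux {p : ℝ} (hp : 1 < p) {Ω : Set E} {u h : E → ℝ} {g : E → E}
    (H : IsWeakSol p Ω u g h) {K : Set E} (hK : IsCompact K) (hKΩ : K ⊆ Ω) :
    MemLp (fun x => flux p (g x)) (ENNReal.ofReal (p / (p - 1))) (volume.restrict K) :=
  PLaplaceHenon.memLp_flux hp (H.memLp K hK hKΩ)

theorem isFiniteMeasure_restrict_isCompact {K : Set E} (hK : IsCompact K) :
    IsFiniteMeasure ((volume : Measure E).restrict K) :=
  ⟨by simpa using hK.measure_lt_top⟩

theorem IsWeakSol.integrableOn_grad {p : ℝ} (hp : 1 < p) {Ω : Set E} {u h : E → ℝ} {g : E → E}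
    (H : IsWeakSol p Ω u g h) (K : Set E) (hK : IsCompact K) (hKΩ : K ⊆ Ω) :
    IntegrableOn g K :=
  have := isFiniteMeasure_restrict_isCompact hK
  (H.memLp K hK hKΩ).integrable (ENNReal.one_le_ofReal.2 hp.le)

theorem IsWeakSol.integrableOn_flux {p : ℝ} (hp : 1 < p) {Ω : Set E} {u h : E → ℝ} {g : E → E}
    (H : IsWeakSol p Ω u g h) (K : Set E) (hK : IsCompact K) (hKΩ : K ⊆ Ω) :
    IntegrableOn (fun x => flux p (g x)) K :=
  have := isFiniteMeasure_restrict_isCompact hK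
  (H.memLp_flux hp hK hKΩ).integrable (one_le_ofReal_conj hp)

/-- Weak comparison principle for the `p`-Laplacian. -/
theorem IsWeakSol.le_of_lt_rhs {p : ℝ} (hp : 1 < p) {Ω : Set E} (hΩ : IsOpen Ω)
    {u v hu hv : E → ℝ} {gu gv : E → E} (Hu : IsWeakSol p Ω u gu hu)
    (Hv : IsWeakSol p Ω v gv hv) (hlt : ∀ x ∈ Ω, hv x < hu x) {K : Set E} (hK : IsCompact K)
    (hKΩ : K ⊆ Ω) (hcontact : ∀ x ∈ Ω, u x ≤ v x → x ∈ K) : ∀ x ∈ Ω, v x ≤ u x := by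
  obtain ⟨ψ, hψ, hψ0, hψ1⟩ := exists_isTest_eq_one_nhds hΩ hK hKΩ
  have := holderTriple_ofReal hp
  -- A smooth stand-in for the positive part: zero on (-∞, 0], positive on (0, ∞), nondecreasing.
  -- The difference of the two equations is tested with ψ · F(v - u).
  have hF : ContDiff ℝ ∞ expNegInvGlue := expNegInvGlue.contDiff
  have hint : ∀ {φ : E → ℝ}, IsTest Ω φ → ∀ {g : E → E},
      (∀ K, IsCompact K → K ⊆ Ω → IntegrableOn g K) →
      Integrable fun x => inner ℝ (g x) (gradient φ x) := fun hφ _ hg =>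
    integrable_inner_of_isCompact hg hφ.continuous_gradient hφ.compact hφ.subset
      fun x hx => gradient_eq_zero_of_notMem_tsupport hx
  obtain ⟨hI, hE⟩ := weak_equation_test_comp (p := ENNReal.ofReal p)
    (p' := ENNReal.ofReal (p / (p - 1))) ENNReal.ofReal_ne_top (ENNReal.one_le_ofReal.2 hp.le)
    (one_le_ofReal_conj hp) hΩ (w := fun x => v x - u x) (h := fun x => hu x - hv x)
    (G := fun x => gv x - gu x) (A := fun x => flux p (gu x) - flux p (gv x))
    (Hv.continuousOn.sub Hu.continuousOn)
    (fun K hK hKΩ => (Hv.memLp K hK hKΩ).sub (Hu.memLp K hK hKΩ))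
    (fun K hK hKΩ => (Hu.memLp_flux hp hK hKΩ).sub (Hv.memLp_flux hp hK hKΩ))
    (Hu.continuousOn_rhs.sub Hv.continuousOn_rhs)
    (Hv.weakGrad.sub hΩ Hv.continuousOn Hu.continuousOn (Hv.integrableOn_grad hp)
      (Hu.integrableOn_grad hp) Hu.weakGrad)
    (fun φ hφ => by
      simp only [inner_sub_left, sub_mul]
      rw [integral_sub (hint hφ (Hu.integrableOn_flux hp)) (hint hφ (Hv.integrableOn_flux hp)),
        integral_sub (integrable_mul_isTest hΩ Hu.continuousOn_rhs hφ.contDiff.continuous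
          hφ.compact hφ.subset) (integrable_mul_isTest hΩ Hv.continuousOn_rhs
          hφ.contDiff.continuous hφ.compact hφ.subset), Hu.integral_eq φ hφ,
        Hv.integral_eq φ hφ])
    hF hψ
  have hle : ∫ x, (hu x - hv x) * (ψ x * expNegInvGlue (v x - u x)) ≤ 0 := by
    rw [← hE]
    refine integral_nonpos fun x => ?_
    -- The cutoff costs nothing: on `K` it is locally constant, and off `K` there is no contact, so
    -- v < u and the glue function vanishes.
    have hzero : expNegInvGlue (v x - u x) • gradient ψ x = 0 := by
      by_cases hx : x ∈ tsupport ψ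
      · by_cases hxK : x ∈ K
        · rw [(hψ1 x hxK).gradient_eq]; simp
        · have : v x - u x ≤ 0 := by
            by_contra h
            exact hxK (hcontact x (hψ.subset hx) (by linarith))
          rw [expNegInvGlue.zero_of_nonpos this, zero_smul]
      · rw [gradient_eq_zero_of_notMem_tsupport hx, smul_zero]
    simp only [hzero, zero_add, inner_smul_right, Pi.zero_apply]
    refine mul_nonpos_of_nonneg_of_nonpos (mul_nonneg (hψ0 x) expNegInvGlue.monotone.deriv_nonneg) ?_
    have := inner_flux_sub_nonneg hp (gu x) (gv x)
    rw [← neg_sub (gu x), inner_neg_right]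
    linarith
  intro x₀ hx₀
  by_contra hlt₀
  push Not at hlt₀
  have hx₀K : x₀ ∈ K := hcontact x₀ hx₀ hlt₀.le
  have hcont : Continuous fun x =>
      ((hu x - hv x) * expNegInvGlue (v x - u x)) * ψ x :=
    continuous_mul_of_tsupport_subset hΩ ((Hu.continuousOn_rhs.sub Hv.continuousOn_rhs).mul
      (hF.continuous.comp_continuousOn (Hv.continuousOn.sub Hu.continuousOn)))
      hψ.contDiff.continuous hψ.subset
  -- A point with u < v makes the right-hand integral strictly positive, because the sources are
  -- strictly ordered. Hence plain monotonicity of the flux is enough.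
  have hpos := hcont.integral_pos_of_hasCompactSupport_nonneg_nonzero (μ := volume)
    (x := x₀) hψ.compact.mul_left (fun x => ?_) ?_
  · refine absurd hle (not_le.2 (hpos.trans_eq ?_))
    congr 1; ext x; ring
  · by_cases hx : x ∈ tsupport ψ
    · exact mul_nonneg (mul_nonneg (sub_nonneg.2 (hlt x (hψ.subset hx)).le)
        (expNegInvGlue.nonneg _)) (hψ0 x)
    · simp [image_eq_zero_of_notMem_tsupport hx]
  · have h1 : ψ x₀ = 1 := (hψ1 x₀ hx₀K).self_of_nhds
    have h2 := expNegInvGlue.pos_of_pos (sub_pos.2 hlt₀)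
    have h3 := sub_pos.2 (hlt x₀ hx₀)
    rw [h1, mul_one]
    exact (mul_pos h3 h2).ne'

end Comparison

/-! ### Gradients and divergences of radial functions and fields. -/

section Radial

theorem hasGradientAt_norm {E : Type*} [NormedAddCommGroup E] [InnerProductSpace ℝ E]
    [CompleteSpace E] {x : E} (hx : x ≠ 0) : HasGradientAt (fun y : E => ‖y‖) (‖x‖⁻¹ • x) x := by
  have hn : 0 < ‖x‖ := norm_pos_iff.2 hx
  have h1 : HasFDerivAt (fun y : E => ‖y‖ ^ 2) (2 • innerSL ℝ x) x := by
    simpa using (hasFDerivAt_id x).norm_sq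
  have h2 := h1.sqrt (by positivity)
  simp only [Real.sqrt_sq (norm_nonneg _)] at h2
  rw [hasGradientAt_iff_hasFDerivAt]
  refine h2.congr_fderiv ?_
  ext v
  simp
  field_simp

theorem hasGradientAt_comp_norm {E : Type*} [NormedAddCommGroup E] [InnerProductSpace ℝ E]
    [CompleteSpace E] {x : E} (hx : x ≠ 0) {m : ℝ → ℝ} {m' : ℝ} (hm : HasDerivAt m m' ‖x‖) :
    HasGradientAt (fun y : E => m ‖y‖) ((m' / ‖x‖) • x) x := by
  rw [hasGradientAt_iff_hasFDerivAt]
  refine (hm.comp_hasFDerivAt x (hasGradientAt_norm hx).hasFDerivAt).congr_fderiv ?_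
  ext v
  simp
  ring

variable {N : ℕ}

/-- The divergence theorem for a radial field `m(|x|) x`, tested against `φ ∈ C_c^∞(Ω)`. -/
theorem integral_inner_radial_gradient {Ω : Set (Space N)} (hΩ : IsOpen Ω)
    (h0 : (0 : Space N) ∉ Ω) {m m' : ℝ → ℝ} (hm : ∀ x ∈ Ω, HasDerivAt m (m' ‖x‖) ‖x‖)
    (hm' : ContinuousOn (fun x : Space N => m' ‖x‖) Ω) {φ : Space N → ℝ} (hφ : IsTest Ω φ) :
    ∫ x, inner ℝ (m ‖x‖ • x) (gradient φ x)
      = ∫ x, (-(m' ‖x‖ * ‖x‖ + N * m ‖x‖)) * φ x := by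
  let b := EuclideanSpace.basisFun (Fin N) ℝ
  have hne : ∀ x ∈ Ω, x ≠ 0 := fun x hx h => h0 (h ▸ hx)
  have hmc : ContinuousOn (fun x : Space N => m ‖x‖) Ω := fun x hx =>
    ((hm x hx).continuousAt.comp continuous_norm.continuousAt).continuousWithinAt
  -- `f i` is the i-th component of the field and `d i` its i-th partial derivative; integration by
  -- parts is done coordinatewise and the `d i` sum to the divergence.
  let f : Fin N → Space N → ℝ := fun i x => m ‖x‖ * inner ℝ (b i) x
  let d : Fin N → Space N → ℝ := fun i x => m' ‖x‖ / ‖x‖ * (inner ℝ (b i) x) ^ 2 + m ‖x‖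
  have hf : ∀ i, ∀ x ∈ Ω, HasFDerivAt (f i) (m ‖x‖ • innerSL ℝ (b i)
      + (inner ℝ (b i) x) • (InnerProductSpace.toDual ℝ _ ((m' ‖x‖ / ‖x‖) • x))) x := by
    intro i x hx
    exact (hasGradientAt_comp_norm (hne x hx) (hm x hx)).hasFDerivAt.mul
      (innerSL ℝ (b i)).hasFDerivAt
  have hfd : ∀ i x, (m ‖x‖ • innerSL ℝ (b i) + (inner ℝ (b i) x) •
      (InnerProductSpace.toDual ℝ _ ((m' ‖x‖ / ‖x‖) • x))) (b i) = d i x := by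
    intro i x
    simp only [add_apply, FunLike.coe_smul, Pi.smul_apply, innerSL_apply_apply, smul_eq_mul,
      InnerProductSpace.toDual_apply_apply, inner_smul_left, real_inner_self_eq_norm_sq,
      b.orthonormal.1 i, d, real_inner_comm (b i) x]
    simp; ring
  have hdc : ∀ i, ContinuousOn (d i) Ω := fun i =>
    ((hm'.div continuous_norm.continuousOn fun x hx => norm_ne_zero_iff.2 (hne x hx)).mul
      ((continuous_const.inner continuous_id).pow 2).continuousOn).add hmc
  have hfc : ∀ i, ContinuousOn (f i) Ω := fun i =>
    hmc.mul (continuous_const.inner continuous_id).continuousOn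
  have hparts : ∀ i, ∫ x, f i x * fderiv ℝ φ x (b i) = -∫ x, d i x * φ x := by
    intro i
    have := integral_mul_fderiv_isTest hΩ (hf i) (v := b i)
      (by simp only [hfd]; exact hdc i) hφ
    simpa only [hfd] using this
  have e1 : ∀ x, inner ℝ (m ‖x‖ • x) (gradient φ x) = ∑ i, f i x * fderiv ℝ φ x (b i) := by
    intro x
    rw [← b.sum_inner_mul_inner]
    refine Finset.sum_congr rfl fun i _ => ?_
    rw [real_inner_comm (gradient φ x), inner_gradient_left, inner_smul_left,
      real_inner_comm (b i) x]
    simp [f]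
  have e2 : ∀ x ∈ Ω, ∑ i, d i x = m' ‖x‖ * ‖x‖ + N * m ‖x‖ := by
    intro x hx
    have hn : ‖x‖ ≠ 0 := norm_ne_zero_iff.2 (hne x hx)
    have : ∑ i, (inner ℝ (b i) x) ^ 2 = ‖x‖ ^ 2 := by
      rw [← b.sum_sq_norm_inner_right x]
      simp
    simp only [d, Finset.sum_add_distrib, ← Finset.mul_sum, this]
    simp
    field_simp
  simp_rw [e1]
  rw [integral_finsetSum]
  · simp_rw [hparts]
    rw [Finset.sum_neg_distrib, ← integral_finsetSum, ← integral_neg]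
    · congr 1
      ext x
      by_cases hx : x ∈ Ω
      · rw [← Finset.sum_mul, e2 x hx]; ring
      · simp [image_eq_zero_of_notMem_tsupport fun h => hx (hφ.subset h)]
    · intro i _
      exact integrable_mul_isTest hΩ (hdc i) hφ.contDiff.continuous hφ.compact hφ.subset
  · intro i _
    obtain ⟨h1, h2, h3⟩ := hφ.continuous_fderiv_apply (b i)
    exact integrable_mul_isTest hΩ (hfc i) h1 h2 h3

end Radial

/-! ### Radial barriers and the resulting lower bounds. -/

section Barrier

/-- The logarithmic weight `1 + κ log (t / 2)`. -/
noncomputable def logWeight (κ t : ℝ) : ℝ := 1 + κ * Real.log (t / 2)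

/-- Minus the derivative of the radial barrier. -/
noncomputable def barrierSlope (n p κ t : ℝ) : ℝ := (logWeight κ t * t ^ (1 - n)) ^ (1 / (p - 1))

/-- The radial barrier, vanishing at `t = R`. -/
noncomputable def barrier (n p κ R t : ℝ) : ℝ := ∫ s in t..R, barrierSlope n p κ s

variable {n p κ : ℝ}

theorem one_le_logWeight (hκ : 0 ≤ κ) {t : ℝ} (ht : 2 ≤ t) : 1 ≤ logWeight κ t := by
  have := mul_nonneg hκ (Real.log_nonneg (by linarith : 1 ≤ t / 2))
  unfold logWeight
  linarith

theorem hasDerivAt_logWeight {t : ℝ} (ht : 0 < t) : HasDerivAt (logWeight κ) (κ / t) t := by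
  have h1 : HasDerivAt (fun t : ℝ => t / 2) (1 / 2) t := (hasDerivAt_id t).div_const 2
  have h2 := ((h1.log (by positivity)).const_mul κ).const_add 1
  refine h2.congr_deriv ?_
  field_simp

theorem continuousOn_barrierSlope (hp : 1 < p) : ContinuousOn (barrierSlope n p κ) (Ioi 0) := by
  have h1 : ContinuousOn (logWeight κ) (Ioi 0) := fun t ht =>
    (hasDerivAt_logWeight ht).continuousAt.continuousWithinAt
  have h2 : ContinuousOn (fun t : ℝ => t ^ (1 - n)) (Ioi 0) :=
    continuousOn_id.rpow_const fun t ht => Or.inl (ne_of_gt ht)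
  exact (h1.mul h2).rpow_const fun t _ => Or.inr (one_div_nonneg.2 (by linarith))

theorem barrierSlope_nonneg (hκ : 0 ≤ κ) {t : ℝ} (ht : 2 ≤ t) : 0 ≤ barrierSlope n p κ t :=
  Real.rpow_nonneg (mul_nonneg (zero_le_one.trans (one_le_logWeight hκ ht))
    (Real.rpow_nonneg (by linarith) _)) _

theorem barrierSlope_rpow (hp : 1 < p) (hκ : 0 ≤ κ) {t : ℝ} (ht : 2 ≤ t) :
    barrierSlope n p κ t ^ (p - 1) = logWeight κ t * t ^ (1 - n) := by
  have h0 : 0 ≤ logWeight κ t * t ^ (1 - n) :=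
    mul_nonneg (zero_le_one.trans (one_le_logWeight hκ ht)) (Real.rpow_nonneg (by linarith) _)
  rw [barrierSlope, ← Real.rpow_mul h0, one_div, inv_mul_cancel₀ (by linarith), Real.rpow_one]

theorem intervalIntegrable_barrierSlope (hp : 1 < p) {s t : ℝ} (hs : 0 < s) (ht : 0 < t) :
    IntervalIntegrable (barrierSlope n p κ) volume s t :=
  ((continuousOn_barrierSlope hp).mono fun _ hx => (lt_min hs ht).trans_le hx.1).intervalIntegrable

theorem hasDerivAt_barrier (hp : 1 < p) {R t : ℝ} (hR : 0 < R) (ht : 0 < t) :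
    HasDerivAt (barrier n p κ R) (-barrierSlope n p κ t) t := by
  have hc := (continuousOn_barrierSlope (n := n) (κ := κ) hp).continuousAt (Ioi_mem_nhds ht)
  exact intervalIntegral.integral_hasDerivAt_left (intervalIntegrable_barrierSlope hp ht hR)
    ((continuousOn_barrierSlope hp).stronglyMeasurableAtFilter isOpen_Ioi t ht) hc

/-- The barrier is bounded uniformly in the outer radius. -/
theorem exists_barrier_le (hp : 1 < p) (hpn : p < n) (hκ : 0 ≤ κ) :
    ∃ I, 0 < I ∧ ∀ R, 2 ≤ R → barrier n p κ R 2 ≤ I := by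
  -- Any δ in (0, n - p) would do: the logarithm is absorbed into t^δ while the total exponent `a`
  -- stays below -1, so the slope is integrable at infinity.
  set δ := (n - p) / 2 with hδ
  have hδ0 : 0 < δ := by rw [hδ]; linarith
  have hs : 0 < 1 / (p - 1) := one_div_pos.2 (by linarith)
  set a := (1 - n + δ) * (1 / (p - 1)) with ha
  have ha1 : a < -1 := by
    rw [ha, mul_one_div, div_lt_iff₀ (by linarith)]
    linarith
  set C := (1 + κ / δ) ^ (1 / (p - 1)) with hC
  have hle : ∀ t ∈ Ioi (2 : ℝ), barrierSlope n p κ t ≤ C * t ^ a := by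
    intro t ht
    have ht2 : (2 : ℝ) < t := ht
    have ht0 : 0 < t := by linarith
    have h1 : logWeight κ t ≤ (1 + κ / δ) * t ^ δ := by
      have h2 : Real.log (t / 2) ≤ t ^ δ / δ :=
        (Real.log_le_rpow_div (by positivity) hδ0).trans (by gcongr; linarith)
      have h3 : 1 ≤ t ^ δ := Real.one_le_rpow (by linarith) hδ0.le
      calc logWeight κ t ≤ t ^ δ + κ * (t ^ δ / δ) := by
            unfold logWeight; gcongr
        _ = _ := by ring
    have h4 := one_le_logWeight hκ ht2.le
    calc barrierSlope n p κ t ≤ ((1 + κ / δ) * t ^ δ * t ^ (1 - n)) ^ (1 / (p - 1)) := by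
          unfold barrierSlope; gcongr
      _ = C * t ^ a := by
          rw [mul_assoc, ← Real.rpow_add ht0, Real.mul_rpow (by positivity) (by positivity),
            ← Real.rpow_mul ht0.le, ha, add_comm δ]
  have hint : IntegrableOn (barrierSlope n p κ) (Ioi 2) := by
    refine ((integrableOn_Ioi_rpow_of_lt ha1 two_pos).const_mul C).mono' ?_ ?_
    · exact ((continuousOn_barrierSlope hp).mono
        (Ioi_subset_Ioi zero_le_two)).aestronglyMeasurable measurableSet_Ioi
    · filter_upwards [ae_restrict_mem measurableSet_Ioi] with t ht
      rw [Real.norm_eq_abs, abs_of_nonneg (barrierSlope_nonneg hκ (le_of_lt ht))]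
      exact hle t ht
  have hnn : 0 ≤ᵐ[volume.restrict (Ioi (2 : ℝ))] barrierSlope n p κ := by
    filter_upwards [ae_restrict_mem measurableSet_Ioi] with t ht
    exact barrierSlope_nonneg hκ (le_of_lt ht)
  have hI : 0 ≤ ∫ t in Ioi (2 : ℝ), barrierSlope n p κ t := integral_nonneg_of_ae hnn
  refine ⟨(∫ t in Ioi (2 : ℝ), barrierSlope n p κ t) + 1, by linarith, fun R hR => ?_⟩
  rw [barrier, intervalIntegral.integral_of_le hR]
  have : ∫ t in Ioc 2 R, barrierSlope n p κ t ≤ ∫ t in Ioi (2 : ℝ), barrierSlope n p κ t :=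
    setIntegral_mono_set hint hnn (Eventually.of_forall fun t ht => ht.1)
  linarith

/-- On [r, 2r] the slope is bounded below by taking the weight at `r` and the power at `2r`. The
interval length `r` supplies the missing power, since (1 - n)/(p - 1) + 1 = -(n - p)/(p - 1). -/
theorem le_barrier_two_mul (hp : 1 < p) (hpn : p < n) (hκ : 0 ≤ κ) {r : ℝ} (hr : 2 ≤ r) :
    (2 : ℝ) ^ ((1 - n) / (p - 1)) * logWeight κ r ^ (1 / (p - 1)) * r ^ (-((n - p) / (p - 1)))
      ≤ barrier n p κ (2 * r) r := by
  have hr0 : 0 < r := by linarith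
  have hp1 : 0 < p - 1 := by linarith
  have hl := one_le_logWeight hκ hr
  set c := (logWeight κ r * (2 * r) ^ (1 - n)) ^ (1 / (p - 1)) with hc
  have hle : ∀ t ∈ Icc r (2 * r), c ≤ barrierSlope n p κ t := by
    intro t ht
    have ht0 : 0 < t := hr0.trans_le ht.1
    have h1 : logWeight κ r ≤ logWeight κ t := by
      unfold logWeight
      have := ht.1
      gcongr
    have h2 : (2 * r) ^ (1 - n) ≤ t ^ (1 - n) :=
      Real.rpow_le_rpow_of_nonpos ht0 ht.2 (by linarith)
    have h3 : 0 ≤ (2 * r) ^ (1 - n) := by positivity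
    exact Real.rpow_le_rpow (mul_nonneg (by linarith) h3)
      (mul_le_mul h1 h2 h3 (by linarith)) (one_div_nonneg.2 hp1.le)
  have h := intervalIntegral.integral_mono_on (a := r) (b := 2 * r) (by linarith)
    (intervalIntegrable_const (c := c)) (intervalIntegrable_barrierSlope (n := n) (κ := κ) hp hr0
      (by linarith)) hle
  rw [intervalIntegral.integral_const, smul_eq_mul] at h
  refine le_trans (le_of_eq ?_) h
  rw [hc, Real.mul_rpow (by linarith) (by positivity), ← Real.rpow_mul (by positivity),
    Real.mul_rpow (by positivity) hr0.le, show 2 * r - r = r by ring, mul_one_div,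
    show -((n - p) / (p - 1)) = (1 - n) / (p - 1) + 1 by field_simp; ring,
    Real.rpow_add_one hr0.ne']
  ring

variable {N : ℕ}

/-- The slope is chosen so that the flux is -λ^(p-1) L(|x|) |x|^(-N) x with L the logarithmic
weight. As |x|^(-N) x is divergence free away from the origin, only L'(t) = κ/t contributes, which
leaves the source κ λ^(p-1) |x|^(-N). -/
theorem isWeakSol_barrier (hp : 1 < p) (hκ : 0 ≤ κ) {lam : ℝ} (hlam : 0 < lam) {R : ℝ}
    (hR : 2 < R) :
    IsWeakSol p {x : Space N | 2 < ‖x‖ ∧ ‖x‖ < R} (fun x => lam * barrier N p κ R ‖x‖)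
      (fun x => (-(lam * barrierSlope N p κ ‖x‖) / ‖x‖) • x)
      (fun x => κ * lam ^ (p - 1) * ‖x‖ ^ (-(N : ℝ))) := by
  set Ω := {x : Space N | 2 < ‖x‖ ∧ ‖x‖ < R} with hΩdef
  have hΩ : IsOpen Ω :=
    (isOpen_lt continuous_const continuous_norm).inter (isOpen_lt continuous_norm continuous_const)
  have hpos : ∀ x ∈ Ω, 0 < ‖x‖ := fun x hx => two_pos.trans hx.1
  have hne : ∀ x ∈ Ω, x ≠ 0 := fun x hx => norm_pos_iff.1 (hpos x hx)
  have hgrad : ∀ x ∈ Ω, HasGradientAt (fun x : Space N => lam * barrier N p κ R ‖x‖)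
      ((-(lam * barrierSlope N p κ ‖x‖) / ‖x‖) • x) x := by
    intro x hx
    refine hasGradientAt_comp_norm (hne x hx) (m := fun t => lam * barrier N p κ R t) ?_
    exact ((hasDerivAt_barrier hp (by linarith) (hpos x hx)).const_mul lam).congr_deriv (by ring)
  have hgc : ContinuousOn (fun x : Space N => (-(lam * barrierSlope N p κ ‖x‖) / ‖x‖) • x) Ω := by
    have h1 : ContinuousOn (fun x : Space N => barrierSlope N p κ ‖x‖) Ω :=
      (continuousOn_barrierSlope hp).comp continuous_norm.continuousOn hpos
    exact (((continuousOn_const.mul h1).neg).div continuous_norm.continuousOn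
      fun x hx => (hpos x hx).ne').smul continuousOn_id
  refine ⟨fun x hx => (hgrad x hx).differentiableAt.continuousAt.continuousWithinAt, ?_,
    weakGrad_of_hasGradientAt hΩ hgrad hgc, ?_, ?_⟩
  · intro K hK hKΩ
    have := isFiniteMeasure_restrict_isCompact hK
    obtain ⟨C, hC⟩ := hK.exists_bound_of_continuousOn (hgc.mono hKΩ)
    refine MemLp.of_bound ((hgc.mono hKΩ).aestronglyMeasurable hK.measurableSet) C ?_
    filter_upwards [ae_restrict_mem hK.measurableSet] with x hx using hC x hx
  · exact continuousOn_const.mul (continuous_norm.continuousOn.rpow_const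
      fun x hx => Or.inl (hpos x hx).ne')
  · intro φ hφ
    set c := lam ^ (p - 1) with hc
    have hflux : ∀ x ∈ Ω, flux p ((-(lam * barrierSlope N p κ ‖x‖) / ‖x‖) • x)
        = (-c * (logWeight κ ‖x‖ * ‖x‖ ^ (-(N : ℝ)))) • x := by
      intro x hx
      have hr := hpos x hx
      have hb := barrierSlope_nonneg (n := N) (p := p) hκ hx.1.le
      have hb0 : 0 < barrierSlope N p κ ‖x‖ := by
        refine hb.lt_of_ne fun h => ?_
        have h1 := barrierSlope_rpow (n := N) hp hκ hx.1.le
        rw [← h, Real.zero_rpow (by linarith)] at h1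
        have h2 := one_le_logWeight hκ hx.1.le
        have : 0 < logWeight κ ‖x‖ * ‖x‖ ^ (1 - (N : ℝ)) :=
          mul_pos (by linarith) (Real.rpow_pos_of_pos hr _)
        linarith
      have hnorm : ‖(-(lam * barrierSlope N p κ ‖x‖) / ‖x‖) • x‖
          = lam * barrierSlope N p κ ‖x‖ := by
        rw [norm_smul, norm_div, norm_neg, norm_norm, Real.norm_eq_abs,
          abs_of_nonneg (by positivity), div_mul_cancel₀ _ hr.ne']
      rw [flux, hnorm, smul_smul]
      congr 1
      have h3 : (lam * barrierSlope N p κ ‖x‖) ^ (p - 2) * (lam * barrierSlope N p κ ‖x‖)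
          = c * (logWeight κ ‖x‖ * ‖x‖ ^ (1 - (N : ℝ))) := by
        rw [← Real.rpow_add_one (by positivity), show p - 2 + 1 = p - 1 by ring,
          Real.mul_rpow hlam.le hb, barrierSlope_rpow hp hκ hx.1.le]
      have h4 : ‖x‖ ^ (-(N : ℝ)) = ‖x‖ ^ (1 - (N : ℝ)) / ‖x‖ := by
        rw [← Real.rpow_sub_one hr.ne']; ring_nf
      rw [h4, mul_div_assoc', mul_neg, h3]
      ring
    have hm : ∀ x ∈ Ω, HasDerivAt (fun t => -c * (logWeight κ t * t ^ (-(N : ℝ))))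
        ((fun t => -c * (κ / t * t ^ (-(N : ℝ)) + logWeight κ t * (-N * t ^ (-(N : ℝ) - 1)))) ‖x‖)
        ‖x‖ := by
      intro x hx
      exact ((hasDerivAt_logWeight (hpos x hx)).mul
        (Real.hasDerivAt_rpow_const (Or.inl (hpos x hx).ne'))).const_mul (-c)
    have hm' : ContinuousOn (fun x : Space N => (fun t => -c * (κ / t * t ^ (-(N : ℝ))
        + logWeight κ t * (-N * t ^ (-(N : ℝ) - 1)))) ‖x‖) Ω := by
      have h1 : ContinuousOn (fun t => -c * (κ / t * t ^ (-(N : ℝ))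
          + logWeight κ t * (-N * t ^ (-(N : ℝ) - 1)))) (Ioi 0) := by
        have hl : ContinuousOn (logWeight κ) (Ioi 0) := fun t ht =>
          (hasDerivAt_logWeight ht).continuousAt.continuousWithinAt
        have hpw : ∀ e : ℝ, ContinuousOn (fun t : ℝ => t ^ e) (Ioi 0) := fun e =>
          continuousOn_id.rpow_const fun t ht => Or.inl (ne_of_gt ht)
        exact continuousOn_const.mul (((continuousOn_const.div continuousOn_id
          fun t ht => ne_of_gt ht).mul (hpw _)).add (hl.mul (continuousOn_const.mul (hpw _))))
      exact h1.comp continuous_norm.continuousOn hpos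
    have hmain := integral_inner_radial_gradient hΩ (fun h => hne 0 h rfl)
      (m' := fun t => -c * (κ / t * t ^ (-(N : ℝ)) + logWeight κ t * (-N * t ^ (-(N : ℝ) - 1))))
      hm hm' hφ
    calc ∫ x, inner ℝ (flux p ((-(lam * barrierSlope N p κ ‖x‖) / ‖x‖) • x)) (gradient φ x)
        = ∫ x, inner ℝ ((-c * (logWeight κ ‖x‖ * ‖x‖ ^ (-(N : ℝ)))) • x) (gradient φ x) := by
          congr 1; ext x
          by_cases hx : x ∈ Ω
          · rw [hflux x hx]
          · rw [gradient_eq_zero_of_notMem_tsupport fun h => hx (hφ.subset h)]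
            simp
      _ = _ := hmain
      _ = _ := by
          congr 1; ext x
          by_cases hx : x ∈ Ω
          · have hr := hpos x hx
            congr 1
            rw [Real.rpow_sub_one hr.ne']
            field_simp
            ring
          · simp [image_eq_zero_of_notMem_tsupport fun h => hx (hφ.subset h)]

/-- Lower bound for positive solutions of `-Δ_p u = h` in an exterior domain. -/
theorem IsWeakSol.exists_lower_bound (hp : 1 < p) (hpN : p < N) (hκ : 0 ≤ κ)
    {u h : Space N → ℝ} {g : Space N → Space N} (H : IsWeakSol p {x : Space N | 1 < ‖x‖} u g h)
    (hu : ∀ x : Space N, 1 < ‖x‖ → 0 < u x) {b : ℝ} (hb : 0 < b)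
    (hh : ∀ x : Space N, 2 < ‖x‖ → κ * b * ‖x‖ ^ (-(N : ℝ)) < h x) :
    ∃ c, 0 < c ∧ ∀ x : Space N, 2 < ‖x‖ →
      c * logWeight κ ‖x‖ ^ (1 / (p - 1)) * ‖x‖ ^ (-((N - p) / (p - 1))) ≤ u x := by
  have hp1 : 0 < p - 1 := by linarith
  obtain ⟨I, hI0, hI⟩ := exists_barrier_le hp hpN hκ
  obtain ⟨μ, hμ0, hμ⟩ := (isCompact_sphere (0 : Space N) 2).exists_forall_le'
    (f := u) (a := 0) (H.continuousOn.mono fun x hx => by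
      rw [mem_sphere_zero_iff_norm] at hx
      simp only [mem_ofPred_eq, hx]; norm_num)
    (fun x hx => hu x (by rw [mem_sphere_zero_iff_norm] at hx; rw [hx]; norm_num))
  -- The first bound keeps the barrier's source below `h`; the second keeps the barrier strictly
  -- below `u` on |x| = 2. Neither depends on the outer radius.
  set lam := min (b ^ (1 / (p - 1))) (μ / (2 * I)) with hlam
  have hlam0 : 0 < lam := lt_min (Real.rpow_pos_of_pos hb _) (by positivity)
  have hlamb : lam ^ (p - 1) ≤ b := by
    calc lam ^ (p - 1) ≤ (b ^ (1 / (p - 1))) ^ (p - 1) :=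
          Real.rpow_le_rpow hlam0.le (min_le_left _ _) hp1.le
      _ = b := by rw [← Real.rpow_mul hb.le, one_div, inv_mul_cancel₀ hp1.ne', Real.rpow_one]
  have hlamI : lam * I < μ := by
    calc lam * I ≤ μ / (2 * I) * I := by gcongr; exact min_le_right _ _
      _ = μ / 2 := by field_simp
      _ < μ := by linarith
  refine ⟨lam * 2 ^ ((1 - N) / (p - 1)), by positivity, fun x hx => ?_⟩
  -- The outer radius depends on the evaluation point, so that `le_barrier_two_mul` applies there.
  set R := 2 * ‖x‖ with hR
  have hR2 : 2 < R := by linarith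
  set Ω := {y : Space N | 2 < ‖y‖ ∧ ‖y‖ < R} with hΩdef
  have hΩ : IsOpen Ω :=
    (isOpen_lt continuous_const continuous_norm).inter (isOpen_lt continuous_norm continuous_const)
  set A := {y : Space N | 2 ≤ ‖y‖ ∧ ‖y‖ ≤ R} with hAdef
  have hA : IsClosed A := (isClosed_le continuous_const continuous_norm).inter
    (isClosed_le continuous_norm continuous_const)
  have hAu : ContinuousOn u A := H.continuousOn.mono fun y hy => by
    have := hy.1
    simp only [mem_ofPred_eq]; linarith
  have hAv : ContinuousOn (fun y => lam * barrier N p κ R ‖y‖) A := by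
    intro y hy
    have h0 : 0 < ‖y‖ := by linarith [hy.1]
    exact (((hasDerivAt_barrier hp (by linarith) h0).continuousAt.comp
      continuous_norm.continuousAt).const_mul lam).continuousWithinAt
  have hK : IsCompact {y ∈ A | u y ≤ lam * barrier N p κ R ‖y‖} := by
    refine (isCompact_closedBall (0 : Space N) R).of_isClosed_subset (hA.isClosed_le hAu hAv) ?_
    intro y hy
    simpa using hy.1.2
  -- Contact is impossible on the boundary: on the inner sphere by the choice of `lam`, on the outer
  -- one because the barrier is 0 and `u` is positive.
  have hKΩ : {y ∈ A | u y ≤ lam * barrier N p κ R ‖y‖} ⊆ Ω := by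
    rintro y ⟨⟨h2, hyR⟩, hle⟩
    refine ⟨h2.lt_of_ne fun h => ?_, hyR.lt_of_ne fun h => ?_⟩
    · have h1 := hμ y (by rw [mem_sphere_zero_iff_norm]; exact h.symm)
      rw [← h] at hle
      have h3 : lam * barrier N p κ R 2 ≤ lam * I := by gcongr; exact hI R hR2.le
      linarith
    · have h1 := hu y (by linarith)
      rw [h, barrier, intervalIntegral.integral_same] at hle
      linarith
  have hcomp := (H.mono (Ω' := Ω) fun y hy => by
      have := hy.1
      simp only [mem_ofPred_eq]; linarith).le_of_lt_rhs hp hΩ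
    (isWeakSol_barrier hp hκ hlam0 hR2) (fun y hy => by
      refine lt_of_le_of_lt ?_ (hh y hy.1)
      gcongr) hK hKΩ (fun y hy hle => ⟨⟨hy.1.le, hy.2.le⟩, hle⟩) x ⟨hx, by linarith⟩
  refine le_trans ?_ hcomp
  have := le_barrier_two_mul hp hpN hκ hx.le
  calc _ = lam * ((2 : ℝ) ^ ((1 - (N : ℝ)) / (p - 1)) * logWeight κ ‖x‖ ^ (1 / (p - 1))
        * ‖x‖ ^ (-((N - p) / (p - 1)))) := by ring
    _ ≤ _ := by gcongr

end Barrier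

/-! ### Picone's inequality and the bound on the potential. -/

section Picone

/-- A smooth function on `ℝ` which agrees with `t ↦ t ^ r` near `[m, ∞)`. -/
theorem exists_contDiff_eq_rpow {m : ℝ} (hm : 0 < m) (r : ℝ) :
    ∃ F : ℝ → ℝ, ContDiff ℝ ∞ F ∧ ∀ t, m ≤ t → F =ᶠ[𝓝 t] fun s => s ^ r := by
  -- The transition factor is 0 for t ≤ m/2, which removes the singularity at 0, and 1 for t ≥ 3m/4.
  refine ⟨fun t => Real.smoothTransition (4 * t / m - 2) * t ^ r, ?_, fun t ht => ?_⟩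
  · rw [contDiff_iff_contDiffAt]
    intro t
    rcases lt_or_ge t (m / 2) with h | h
    · have : (fun t => Real.smoothTransition (4 * t / m - 2) * t ^ r) =ᶠ[𝓝 t] fun _ => 0 := by
        filter_upwards [Iio_mem_nhds h] with s hs
        have hs' : s < m / 2 := hs
        rw [Real.smoothTransition.zero_of_nonpos, zero_mul]
        rw [sub_nonpos, div_le_iff₀ hm]
        linarith
      exact contDiffAt_const.congr_of_eventuallyEq this
    · have ht : 0 < t := by linarith
      have h1 : ContDiff ℝ ∞ fun t : ℝ => 4 * t / m - 2 := by fun_prop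
      exact ((Real.smoothTransition.contDiff.comp h1).contDiffAt).mul
        (Real.contDiffAt_rpow_const_of_ne ht.ne')
  · filter_upwards [Ioi_mem_nhds (show 3 * m / 4 < t by linarith)] with s hs
    have hs' : 3 * m / 4 < s := hs
    rw [Real.smoothTransition.one_of_one_le, one_mul]
    rw [le_sub_iff_add_le, le_div_iff₀ hm]
    linarith

/-- The scalar inequality behind Picone's inequality with power cutoffs. -/
theorem picone_scalar {p : ℝ} (hp : 1 < p) {k : ℕ} (hk : p ≤ k) {s a b : ℝ} (hs : 0 ≤ s)
    (hs1 : s ≤ 1) (ha : 0 ≤ a) (hb : 0 ≤ b) :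
    k * s ^ (k - 1) * (a ^ (p - 1) * b) - (p - 1) * (s ^ k * a ^ p) ≤ (k / p * b) ^ p := by
  have hp0 : 0 < p := by linarith
  have hk0 : (0 : ℝ) < k := hp0.trans_le hk
  have hk1 : 1 ≤ k := by exact_mod_cast Nat.one_le_iff_ne_zero.2 (by rintro rfl; simp at hk0)
  -- With this `X` the absorbed term is exactly (p - 1) X^p, and Young's inequality for X^(p-1) · (k
  -- b / p) closes the estimate.
  set X := s ^ ((k : ℝ) / p) * a with hX
  have hX0 : 0 ≤ X := by positivity
  have hXp : X ^ p = s ^ k * a ^ p := by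
    rw [hX, Real.mul_rpow (by positivity) ha, ← Real.rpow_mul hs, div_mul_cancel₀ _ hp0.ne',
      Real.rpow_natCast]
  have hXp1 : s ^ (k - 1) * a ^ (p - 1) ≤ X ^ (p - 1) := by
    rw [hX, Real.mul_rpow (by positivity) ha, ← Real.rpow_mul hs]
    gcongr
    rw [← Real.rpow_natCast, Nat.cast_sub hk1, Nat.cast_one]
    -- This is where k ≥ p enters; together with s ≤ 1 it lets s^(k-1) be dominated by the power of
    -- `s` in X^(p-1).
    have he : (k : ℝ) / p * (p - 1) ≤ k - 1 := by
      have : 1 ≤ (k : ℝ) / p := (one_le_div hp0).2 hk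
      have h2 : (k : ℝ) / p * (p - 1) = k - k / p := by field_simp
      linarith
    have he0 : 0 < (k : ℝ) / p * (p - 1) := mul_pos (by positivity) (by linarith)
    rcases hs.eq_or_lt with rfl | hs0
    · rw [Real.zero_rpow he0.ne', Real.zero_rpow (by linarith)]
    · exact Real.rpow_le_rpow_of_exponent_ge hs0 hs1 he
  have hY0 : 0 ≤ (k : ℝ) / p * b := by positivity
  have hyoung := Real.young_inequality_of_nonneg (Real.rpow_nonneg hX0 (p - 1)) hY0
    (Real.HolderConjugate.conjExponent hp).symm
  rw [← Real.rpow_mul hX0, Real.conjExponent, mul_div_cancel₀ _ (by linarith : p - 1 ≠ 0)]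
    at hyoung
  have h1 : p * (X ^ (p - 1) * (k / p * b)) ≤ (p - 1) * X ^ p + (k / p * b) ^ p := by
    calc p * (X ^ (p - 1) * (k / p * b))
        ≤ p * (X ^ p / (p / (p - 1)) + (k / p * b) ^ p / p) := by gcongr
      _ = _ := by
        have : p - 1 ≠ 0 := by linarith
        field_simp
  have h2 : k * s ^ (k - 1) * (a ^ (p - 1) * b) ≤ p * (X ^ (p - 1) * (k / p * b)) := by
    calc k * s ^ (k - 1) * (a ^ (p - 1) * b) = k * b * (s ^ (k - 1) * a ^ (p - 1)) := by ring
      _ ≤ k * b * X ^ (p - 1) := by gcongr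
      _ = _ := by field_simp
  rw [← hXp]
  linarith

variable {E : Type*} [NormedAddCommGroup E] [InnerProductSpace ℝ E] [FiniteDimensional ℝ E]
  [MeasurableSpace E] [BorelSpace E]

/-- Picone's inequality: the weak equation tested with `ψ ^ k * u ^ (1 - p)`. -/
theorem IsWeakSol.picone {p : ℝ} (hp : 1 < p) {Ω : Set E} (hΩ : IsOpen Ω) {u h : E → ℝ}
    {g : E → E} (H : IsWeakSol p Ω u g h) (hu : ∀ x ∈ Ω, 0 < u x) {k : ℕ} (hk : p ≤ k)
    {ψ : E → ℝ} (hψ : IsTest Ω ψ) (hψ0 : ∀ x, 0 ≤ ψ x) (hψ1 : ∀ x, ψ x ≤ 1) :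
    ∫ x, h x * (ψ x ^ k * u x ^ (1 - p)) ≤ ∫ x, (k / p * ‖gradient ψ x‖) ^ p := by
  have hp0 : 0 < p := by linarith
  have hk0 : k ≠ 0 := by
    rintro rfl
    simp only [Nat.cast_zero] at hk
    linarith
  -- A positive lower bound for `u` on the support of ψ allows t^(1-p) to be replaced by a globally
  -- smooth `F`.
  obtain ⟨m, hm0, hm⟩ := hψ.compact.exists_forall_le' (H.continuousOn.mono hψ.subset)
    (fun x hx => hu x (hψ.subset hx))
  obtain ⟨F, hF, hFeq⟩ := exists_contDiff_eq_rpow hm0 (1 - p)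
  have := holderTriple_ofReal hp
  obtain ⟨hI, hE⟩ := weak_equation_test_comp (p := ENNReal.ofReal p)
    (p' := ENNReal.ofReal (p / (p - 1))) ENNReal.ofReal_ne_top (ENNReal.one_le_ofReal.2 hp.le)
    (one_le_ofReal_conj hp) hΩ H.continuousOn H.memLp (fun K hK hKΩ => H.memLp_flux hp hK hKΩ)
    H.continuousOn_rhs H.weakGrad H.integral_eq hF (hψ.pow hk0)
  have hrhs : ∫ x, h x * (ψ x ^ k * u x ^ (1 - p)) = ∫ x, h x * (ψ x ^ k * F (u x)) := by
    congr 1; ext x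
    by_cases hx : x ∈ tsupport ψ
    · rw [(hFeq _ (hm x hx)).self_of_nhds]
    · simp [image_eq_zero_of_notMem_tsupport hx, hk0]
  rw [hrhs, ← hE]
  have hgsupp : HasCompactSupport fun x => (k / p * ‖gradient ψ x‖) ^ p := by
    refine HasCompactSupport.of_support_subset_isCompact hψ.compact fun x hx => ?_
    by_contra hxK
    exact hx (by simp [gradient_eq_zero_of_notMem_tsupport hxK, Real.zero_rpow hp0.ne'])
  have hgcont : Continuous fun x => (k / p * ‖gradient ψ x‖) ^ p :=
    (continuous_const.mul hψ.continuous_gradient.norm).rpow_const fun _ => Or.inr hp0.le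
  refine integral_mono hI (hgcont.integrable_of_hasCompactSupport hgsupp) fun x => ?_
  by_cases hx : x ∈ tsupport ψ
  · have hux : 0 < u x := hu x (hψ.subset hx)
    have hF1 : F (u x) = u x ^ (1 - p) := (hFeq _ (hm x hx)).self_of_nhds
    have hF2 : deriv F (u x) = (1 - p) * u x ^ (-p) := by
      rw [(hFeq _ (hm x hx)).deriv_eq, Real.deriv_rpow_const]
      ring_nf
    have hgr : gradient (fun x => ψ x ^ k) x = (k * ψ x ^ (k - 1)) • gradient ψ x := by
      apply ext_inner_right ℝ
      intro v
      rw [inner_smul_left, inner_gradient_left, inner_gradient_left,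
        ((hψ.differentiable x).hasFDerivAt.pow k).fderiv]
      simp
    simp only [hF1, hF2, hgr, inner_add_right, inner_smul_right, inner_flux_self hp]
    have h1 : inner ℝ (flux p (g x)) (gradient ψ x) ≤ ‖g x‖ ^ (p - 1) * ‖gradient ψ x‖ := by
      rw [← norm_flux hp]; exact real_inner_le_norm _ _
    -- The scalar inequality is used with s = ψ, a = |g|/u and b = |∇ψ|.
    have h2 := picone_scalar hp hk (hψ0 x) (hψ1 x) (div_nonneg (norm_nonneg (g x)) hux.le)
      (norm_nonneg (gradient ψ x))
    refine le_trans ?_ h2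
    rw [Real.div_rpow (norm_nonneg _) hux.le, Real.div_rpow (norm_nonneg _) hux.le,
      show 1 - p = -(p - 1) by ring, Real.rpow_neg hux.le, Real.rpow_neg hux.le]
    have h3 : 0 ≤ (u x ^ (p - 1))⁻¹ * (k * ψ x ^ (k - 1)) := by
      have := hψ0 x
      positivity
    calc _ = (u x ^ (p - 1))⁻¹ * (k * ψ x ^ (k - 1)) * inner ℝ (flux p (g x)) (gradient ψ x)
          - (p - 1) * (ψ x ^ k * (‖g x‖ ^ p / u x ^ p)) := by ring
      _ ≤ (u x ^ (p - 1))⁻¹ * (k * ψ x ^ (k - 1)) * (‖g x‖ ^ (p - 1) * ‖gradient ψ x‖)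
          - (p - 1) * (ψ x ^ k * (‖g x‖ ^ p / u x ^ p)) := by gcongr
      _ = _ := by ring
  · have h1 : gradient (fun x => ψ x ^ k) x = 0 :=
      gradient_eq_zero_of_notMem_tsupport fun h => hx (tsupport_pow_subset ψ hk0 h)
    simp only [h1, image_eq_zero_of_notMem_tsupport hx, ne_eq, hk0, not_false_eq_true, zero_pow,
      zero_mul, zero_smul, smul_zero, add_zero, inner_zero_right]
    positivity

variable {N : ℕ}

/-- On the annuli `3R ≤ |x| ≤ 5R`, the potential `h / u^{p-1}` of a positive solution has
infimum `O(R^{-p})`. -/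
theorem IsWeakSol.exists_potential_bound {p : ℝ} (hp : 1 < p) (hN : 0 < N)
    {u h : Space N → ℝ} {g : Space N → Space N} (H : IsWeakSol p {x : Space N | 1 < ‖x‖} u g h)
    (hu : ∀ x : Space N, 1 < ‖x‖ → 0 < u x) (hh : ∀ x : Space N, 1 < ‖x‖ → 0 ≤ h x) :
    ∃ C, ∀ R, 1 < R → ∀ θ, (∀ x : Space N, 3 * R ≤ ‖x‖ → ‖x‖ ≤ 5 * R → θ ≤ h x * u x ^ (1 - p)) →
      θ ≤ C * R ^ (-p) := by
  have hp0 : 0 < p := by linarith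
  set Ω := {x : Space N | 1 < ‖x‖} with hΩdef
  have hΩ : IsOpen Ω := isOpen_lt continuous_const continuous_norm
  obtain ⟨k, hk⟩ := exists_nat_ge p
  have hk0 : k ≠ 0 := by
    rintro rfl
    simp only [Nat.cast_zero] at hk
    linarith
  let η : ContDiffBump (0 : Space N) := ⟨1, 2, one_pos, one_lt_two⟩
  have hη : ContDiff ℝ ∞ η := η.contDiff
  obtain ⟨M, hM⟩ := (hη.continuous_fderiv (by simp)).bounded_above_of_compact_support
    (η.hasCompactSupport.fderiv ℝ)
  have hM0 : 0 ≤ M := (norm_nonneg _).trans (hM 0)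
  refine ⟨(k / p * M) ^ p * 2 ^ N, fun R hR θ hθ => ?_⟩
  have hR0 : 0 < R := by linarith
  -- With |x₀| = 4R, the ball of radius R where ψ = 1 lies in the annulus 3R ≤ |x| ≤ 5R, and the
  -- ball of radius 2R containing the support lies in |x| ≥ 2R > 1.
  set x₀ : Space N := EuclideanSpace.single ⟨0, hN⟩ (4 * R) with hx₀def
  have hx₀ : ‖x₀‖ = 4 * R := by
    rw [hx₀def, PiLp.norm_single, Real.norm_eq_abs, abs_of_pos (by linarith)]
  set ψ : Space N → ℝ := fun x => η (R⁻¹ • (x - x₀)) with hψdef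
  have hnorm : ∀ x, ‖R⁻¹ • (x - x₀)‖ = dist x x₀ / R := fun x => by
    rw [norm_smul, norm_inv, Real.norm_eq_abs, abs_of_pos hR0, dist_eq_norm]; ring
  have hsupp : tsupport ψ ⊆ closedBall x₀ (2 * R) := by
    refine closure_minimal (fun x hx => ?_) isClosed_closedBall
    by_contra hxb
    rw [mem_closedBall, not_le] at hxb
    refine hx (η.zero_of_le_dist ?_)
    rw [dist_zero_right, hnorm, le_div_iff₀ hR0]
    exact hxb.le
  have hballΩ : closedBall x₀ (2 * R) ⊆ Ω := by
    intro x hx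
    rw [mem_closedBall, dist_eq_norm] at hx
    have h1 : ‖x₀‖ - ‖x - x₀‖ ≤ ‖x‖ := by
      have := norm_sub_norm_le x₀ (x₀ - x)
      rw [sub_sub_cancel, norm_sub_rev] at this
      exact this
    simp only [hΩdef, mem_ofPred_eq]
    linarith
  have haff : ContDiff ℝ ∞ fun x : Space N => R⁻¹ • (x - x₀) := by fun_prop
  have hψ : IsTest Ω ψ := ⟨hη.comp haff,
    (isCompact_closedBall x₀ (2 * R)).of_isClosed_subset (isClosed_tsupport _) hsupp,
    hsupp.trans hballΩ⟩
  have hψgrad : ∀ x, ‖gradient ψ x‖ ≤ M / R := by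
    intro x
    have h1 : HasFDerivAt (fun x : Space N => R⁻¹ • (x - x₀))
        (R⁻¹ • ContinuousLinearMap.id ℝ (Space N)) x :=
      ((hasFDerivAt_id x).sub_const x₀).const_smul R⁻¹
    have h2 : fderiv ℝ ψ x = _ :=
      ((hη.differentiable (by simp) _).hasFDerivAt.comp x h1).fderiv
    rw [gradient, LinearIsometryEquiv.norm_map, h2, comp_smul, comp_id, norm_smul, norm_inv,
      Real.norm_eq_abs, abs_of_pos hR0, div_eq_inv_mul]
    gcongr
    exact hM _
  have hpic := H.picone hp hΩ hu hk hψ (fun x => η.nonneg) (fun x => η.le_one)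
  set V := (volume : Measure (Space N)).real (ball (0 : Space N) 1) with hV
  have hVpos : 0 < V := ENNReal.toReal_pos (measure_ball_pos _ _ one_pos).ne' measure_ball_lt_top.ne
  have hvol : ∀ r, 0 ≤ r → (volume : Measure (Space N)).real (closedBall x₀ r) = r ^ N * V := by
    intro r hr
    rw [Measure.addHaar_real_closedBall _ _ hr, finrank_euclideanSpace_fin]
  have hupper : ∫ x, (k / p * ‖gradient ψ x‖) ^ p ≤ (2 * R) ^ N * V * (k / p * (M / R)) ^ p := by
    rw [← hvol _ (by linarith), ← smul_eq_mul, ← setIntegral_const,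
      ← integral_indicator measurableSet_closedBall]
    refine integral_mono_of_nonneg (Eventually.of_forall fun x => ?_) ?_
      (Eventually.of_forall fun x => ?_)
    · simp only [Pi.zero_apply]; positivity
    · exact (integrable_indicator_iff measurableSet_closedBall).2
        (integrableOn_const measure_closedBall_lt_top.ne)
    · by_cases hx : x ∈ closedBall x₀ (2 * R)
      · simp only [indicator_of_mem hx]
        gcongr
        exact hψgrad x
      · simp [indicator_of_notMem hx,
          gradient_eq_zero_of_notMem_tsupport fun h => hx (hsupp h), Real.zero_rpow hp0.ne']
  have hlower : R ^ N * V * θ ≤ ∫ x, h x * (ψ x ^ k * u x ^ (1 - p)) := by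
    rw [← hvol _ hR0.le, ← smul_eq_mul, ← setIntegral_const,
      ← integral_indicator measurableSet_closedBall]
    refine integral_mono ((integrable_indicator_iff measurableSet_closedBall).2
        (integrableOn_const measure_closedBall_lt_top.ne)) ?_ fun x => ?_
    · have hc : ContinuousOn (fun x => h x * u x ^ (1 - p)) Ω :=
        H.continuousOn_rhs.mul (H.continuousOn.rpow_const fun x hx => Or.inl (hu x hx).ne')
      have := integrable_mul_isTest hΩ hc (hψ.pow hk0).contDiff.continuous (hψ.pow hk0).compact
        (hψ.pow hk0).subset
      refine this.congr (Eventually.of_forall fun x => ?_)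
      simp only; ring
    · by_cases hx : x ∈ closedBall x₀ R
      · have h1 : ψ x = 1 := by
          refine η.one_of_mem_closedBall ?_
          rw [mem_closedBall_zero_iff, hnorm, div_le_iff₀ hR0]
          simpa [η] using hx
        rw [mem_closedBall, dist_eq_norm] at hx
        have h2 := norm_sub_norm_le x₀ (x₀ - x)
        rw [sub_sub_cancel, norm_sub_rev] at h2
        have h3 := norm_sub_norm_le x x₀
        have h4 := hθ x (by linarith) (by linarith)
        rw [indicator_of_mem (by rwa [mem_closedBall, dist_eq_norm]), h1, one_pow, one_mul]
        exact h4
      · rw [indicator_of_notMem hx]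
        by_cases hxs : x ∈ tsupport ψ
        · have hxΩ : x ∈ Ω := hψ.subset hxs
          exact mul_nonneg (hh x hxΩ) (mul_nonneg (pow_nonneg η.nonneg _)
            (Real.rpow_nonneg (hu x hxΩ).le _))
        · simp [image_eq_zero_of_notMem_tsupport hxs, hk0]
  have hall := hlower.trans (hpic.trans hupper)
  have hRV : 0 < R ^ N * V := by positivity
  -- The volumes of the two balls differ by the factor 2^N, and the gradient bound M/R contributes
  -- R^(-p).
  have hfin : (2 * R) ^ N * V * (k / p * (M / R)) ^ p
      = R ^ N * V * ((k / p * M) ^ p * 2 ^ N * R ^ (-p)) := by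
    rw [mul_div_assoc', Real.div_rpow (by positivity) hR0.le, Real.rpow_neg hR0.le, mul_pow]
    ring
  rw [hfin] at hall
  exact le_of_mul_le_mul_left hall hRV

end Picone

/-! ### The two-step lower bound and the contradiction. -/

section Main

variable {N : ℕ}

theorem IsContinuousSolution.exists_isWeakSol {p α q : ℝ} {u : Space N → ℝ}
    (hu : ∀ x ∈ exteriorDomain N, 0 < u x)
    (H : IsContinuousSolution p α q (exteriorDomain N) u) :
    ∃ g, IsWeakSol p {x : Space N | 1 < ‖x‖} u g fun x => ‖x‖ ^ α * u x ^ q := by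
  obtain ⟨hc, g, hg, hgp, heq⟩ := H
  have hset : ∀ {f : Space N → ℝ} {φ : Space N → ℝ}, IsTest {x : Space N | 1 < ‖x‖} φ →
      (∀ x, x ∉ tsupport φ → f x = 0) →
      ∫ x in (exteriorDomain N : Set (Space N)), f x = ∫ x, f x := fun hφ hf =>
    setIntegral_eq_integral_of_forall_compl_eq_zero fun x hx => hf x fun h => hx (hφ.subset h)
  refine ⟨g, hc, hgp, fun φ hφ v => ?_, ?_, fun φ hφ => ?_⟩
  · have h1 := hg.integral_eq v ⟨φ, hφ.contDiff, hφ.compact, hφ.subset⟩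
    rw [hset hφ fun x hx => ?_, hset hφ fun x hx => ?_] at h1
    · exact h1
    · exact mul_eq_zero_of_right _ (image_eq_zero_of_notMem_tsupport hx)
    · have h2 : fderiv ℝ φ x = 0 := by
        by_contra h
        exact hx (support_fderiv_subset ℝ h)
      change u x * fderiv ℝ φ x v = 0
      simp [h2]
  · refine (continuous_norm.continuousOn.rpow_const fun x hx => Or.inl ?_).mul
      (hc.rpow_const fun x hx => Or.inl (hu x hx).ne')
    have : (1 : ℝ) < ‖x‖ := hx
    linarith
  · have h1 := heq ⟨φ, hφ.contDiff, hφ.compact, hφ.subset⟩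
    rw [hset hφ fun x hx => ?_, hset hφ fun x hx => ?_] at h1
    · exact h1
    · exact mul_eq_zero_of_right _ (image_eq_zero_of_notMem_tsupport hx)
    · change inner ℝ _ (gradient φ x) = 0
      rw [gradient_eq_zero_of_notMem_tsupport hx, inner_zero_right]

theorem IsWeakSol.false_of_exponent_le {p q α : ℝ} (hp : 1 < p) (hpN : p < N) (hq : p - 1 < q)
    (hqle : q ≤ (N + α) * (p - 1) / (N - p)) {u : Space N → ℝ} {g : Space N → Space N}
    (hu : ∀ x : Space N, 1 < ‖x‖ → 0 < u x)
    (H : IsWeakSol p {x : Space N | 1 < ‖x‖} u g fun x => ‖x‖ ^ α * u x ^ q) : False := by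
  have hp1 : 0 < p - 1 := by linarith
  have hNp : 0 < N - p := by linarith
  have hN : 0 < N := by
    have : (0 : ℝ) < N := by linarith
    exact_mod_cast this
  set β := (N - p) / (p - 1) with hβ
  have hβq : β * q ≤ N + α := by
    rw [le_div_iff₀ hNp] at hqle
    rw [hβ, div_mul_eq_mul_div, div_le_iff₀ hp1]
    linarith
  have hβp : β * (p - 1) = N - p := div_mul_cancel₀ _ hp1.ne'
  have hrhs : ∀ x : Space N, 1 < ‖x‖ → 0 < ‖x‖ ^ α * u x ^ q := fun x hx =>
    mul_pos (Real.rpow_pos_of_pos (by linarith) _) (Real.rpow_pos_of_pos (hu x hx) _)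
  -- With κ = 0 the weight is 1 and the barrier is p-harmonic, so positivity of the right-hand side
  -- is all that is required.
  obtain ⟨c₁, hc₁, hlow₁⟩ := H.exists_lower_bound hp hpN le_rfl hu one_pos
    (fun x hx => by simpa using hrhs x (by linarith))
  -- With κ = 1 the first bound feeds the source: |x|^α u^q ≥ c₁^q |x|^(α-βq) ≥ c₁^q |x|^(-N).
  -- Halving c₁^q gives the strict inequality.
  obtain ⟨c, hc, hlow⟩ := H.exists_lower_bound hp hpN zero_le_one hu
    (b := c₁ ^ q / 2) (by positivity) (fun x hx => by
      have hx0 : 0 < ‖x‖ := by linarith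
      have h1 : c₁ * ‖x‖ ^ (-β) ≤ u x := by simpa [logWeight] using hlow₁ x hx
      have h2 : c₁ ^ q * ‖x‖ ^ (-β * q) ≤ u x ^ q := by
        rw [Real.rpow_mul hx0.le, ← Real.mul_rpow hc₁.le (by positivity)]
        exact Real.rpow_le_rpow (by positivity) h1 (by linarith)
      have h3 : ‖x‖ ^ (-(N : ℝ)) ≤ ‖x‖ ^ (α + -β * q) :=
        Real.rpow_le_rpow_of_exponent_le (by linarith) (by linarith)
      have h4 : 0 < c₁ ^ q * ‖x‖ ^ (-(N : ℝ)) := by positivity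
      calc 1 * (c₁ ^ q / 2) * ‖x‖ ^ (-(N : ℝ)) < c₁ ^ q * ‖x‖ ^ (-(N : ℝ)) := by linarith
        _ ≤ c₁ ^ q * ‖x‖ ^ (α + -β * q) := by gcongr
        _ = ‖x‖ ^ α * (c₁ ^ q * ‖x‖ ^ (-β * q)) := by rw [Real.rpow_add hx0]; ring
        _ ≤ ‖x‖ ^ α * u x ^ q := by gcongr)
  obtain ⟨C, hC⟩ := H.exists_potential_bound hp hN hu fun x hx => (hrhs x hx).le
  have he : 0 < q - (p - 1) := by linarith
  have hbound : ∀ R, 2 ≤ R →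
      (c * logWeight 1 R ^ (1 / (p - 1))) ^ (q - (p - 1)) ≤ C * 5 ^ p := by
    intro R hR
    have hR0 : 0 < R := by linarith
    have hL := one_le_logWeight zero_le_one hR
    set B := c * logWeight 1 R ^ (1 / (p - 1)) with hB
    have hB0 : 0 < B := by positivity
    have hθ : B ^ (q - (p - 1)) * (5 * R) ^ (-p) ≤ C * R ^ (-p) := by
      refine hC R (by linarith) _ fun x hx3 hx5 => ?_
      have hx0 : 0 < ‖x‖ := by linarith
      have hux := hu x (by linarith)
      have h1 : B * ‖x‖ ^ (-β) ≤ u x := by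
        refine le_trans ?_ (hlow x (by linarith))
        have : logWeight 1 R ≤ logWeight 1 ‖x‖ := by
          unfold logWeight
          gcongr
          linarith
        rw [hB]
        gcongr
      have h2 : B ^ (q - (p - 1)) * ‖x‖ ^ (-β * (q - (p - 1))) ≤ u x ^ (q - (p - 1)) := by
        rw [Real.rpow_mul hx0.le, ← Real.mul_rpow hB0.le (by positivity)]
        exact Real.rpow_le_rpow (by positivity) h1 he.le
      -- The exponent is at least -p, because βq ≤ N + α and β(p - 1) = N - p.
      have h3 : (5 * R) ^ (-p) ≤ ‖x‖ ^ (α + -β * (q - (p - 1))) :=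
        (Real.rpow_le_rpow_of_nonpos hx0 hx5 (by linarith)).trans
          (Real.rpow_le_rpow_of_exponent_le (by linarith) (by linarith))
      calc B ^ (q - (p - 1)) * (5 * R) ^ (-p)
          ≤ B ^ (q - (p - 1)) * ‖x‖ ^ (α + -β * (q - (p - 1))) := by gcongr
        _ = ‖x‖ ^ α * (B ^ (q - (p - 1)) * ‖x‖ ^ (-β * (q - (p - 1)))) := by
            rw [Real.rpow_add hx0]; ring
        _ ≤ ‖x‖ ^ α * u x ^ (q - (p - 1)) := by gcongr
        _ = ‖x‖ ^ α * u x ^ q * u x ^ (1 - p) := by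
            rw [mul_assoc, ← Real.rpow_add hux]; ring_nf
    rw [Real.mul_rpow (by norm_num) hR0.le, Real.rpow_neg (by norm_num : (0 : ℝ) ≤ 5),
      ← mul_assoc] at hθ
    have h5 := le_of_mul_le_mul_right hθ (by positivity)
    rwa [← div_eq_mul_inv, div_le_iff₀ (by positivity)] at h5
  have htend : Tendsto (fun R => (c * logWeight 1 R ^ (1 / (p - 1))) ^ (q - (p - 1)))
      atTop atTop := by
    have h1 : Tendsto (logWeight 1) atTop atTop :=
      tendsto_atTop_add_const_left _ _ ((Real.tendsto_log_atTop.comp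
        (tendsto_id.atTop_div_const two_pos)).const_mul_atTop one_pos)
    exact (tendsto_rpow_atTop he).comp (((tendsto_rpow_atTop (one_div_pos.2 hp1)).comp
      h1).const_mul_atTop hc)
  obtain ⟨R, hR, hR2⟩ := ((htend.eventually_gt_atTop (C * 5 ^ p)).and
    (eventually_ge_atTop 2)).exists
  exact absurd (hbound R hR2) (not_le.2 hR)

end Main

end PLaplaceHenon

theorem theorem5p1 (N : ℕ) (p q α : ℝ) (hp : 1 < p) (hpN : p < N) (hq : p - 1 < q)
    (hqle : q ≤ (N + α) * (p - 1) / (N - p)) :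
    ¬ ∃ u : PLaplaceHenon.Space N → ℝ,
      (∀ x ∈ PLaplaceHenon.exteriorDomain N, 0 < u x) ∧
      PLaplaceHenon.IsContinuousSolution p α q (PLaplaceHenon.exteriorDomain N) u := by
  rintro ⟨u, hu, H⟩
  obtain ⟨g, hg⟩ := H.exists_isWeakSol hu
  exact hg.false_of_exponent_le hp hpN hq hqle hu
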